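/- Let $A,B\in\mathbb C^{n\times n}$ be such that the pencil $A-\lambda B$ is singular, i.e. $\det(A-\lambda B)\equiv 0$, and has normal rank $\max_{\zeta\in\mathbb C}\operatorname{rank}(A-\zeta B)=n-k$. Let $n_1,\dots,n_k$ be its left and $m_1,\dots,m_k$ its right minimal indices (the sizes of the blocks $L_{n_i}(\lambda)^{\top}$ and $L_{m_i}(\lambda)$, where $L_j(\lambda)=[0\ \,I_j]-\lambda[I_j\ \,0]$, in the Kronecker canonical form), and put $N=n_1+\cdots+n_k$, $M=m_1+\cdots+m_k$. A point $\lambda_0\in\mathbb C$ is an eigenvalue of a pencil if $\operatorname{rank}(A-\lambda_0B)$ is less than the normal rank, and $\infty$ is an eigenvalue if $\operatorname{rank} B$ is less than the normal rank. Let $D_A=\operatorname{diag}(a_1,\dots,a_k)$ and $D_B=\operatorname{diag}(b_1,\dots,b_k)$ be complex matrices such that $D_A-\lambda D_B$ is regular and none of the values $\gamma_i=a_i/b_i\in\mathbb C\cup\{\infty\}$ (with $\gamma_i=\infty$ if $b_i=0$; repetitions are allowed) is an eigenvalue of $A-\lambda B$. For $U,V\in\mathbb C^{n\times k}$ of full column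 rank and $\tau\in\mathbb C\setminus\{0\}$ consider $$\widetilde A-\lambda\widetilde B=A-\lambda B+\tau\,U(D_A-\lambda D_B)V^*.$$ For a finite $\lambda_0$ let $\mathcal N_r(\lambda_0)=\ker(\widetilde A-\lambda_0\widetilde B)$ and $\mathcal N_l(\lambda_0)=\ker\big((\widetilde A-\lambda_0\widetilde B)^*\big)$, and let $\mathcal N_r(\infty)=\ker\widetilde B$, $\mathcal N_l(\infty)=\ker(\widetilde B^*)$. The algebraic multiplicity of an eigenvalue of a regular pencil of size $\ell$ is its multiplicity as a root of the determinant polynomial if it is finite, and $\ell$ minus the degree of that polynomial if it is $\infty$; an eigenvalue is simple if its algebraic multiplicity is $1$. Then, generically with respect to the entries of $U$ and $V^*$ (that is, for all $(U,V)$ of full column rank such that $(U,V^*)$, regarded as a point of $\mathbb C^{2nk}$, lies outside a proper algebraic subset of $\mathbb C^{2nk}$ that may depend on $A,B,D_A,D_B$ but not on $\tau$), the pencil $\widetilde A-\lambda\widetilde B$ is regular for all $\tau\ne0$, and there are pairwise distinct numbers $\alpha_1,\dots,\alpha_M,\beta_1,\dots,\beta_N\in\mathbb C$, independent of $\tau$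 and different from all eigenvalues of $A-\lambda B$ and from $\gamma_1,\dots,\gamma_k$, such that the following holds. 1. For each $i=1,\dots,M$ and all $\tau\neq0$, $\alpha_i$ is a simple eigenvalue of $\widetilde A-\lambda\widetilde B$. There is a nonzero vector $x_i$, independent of $\tau$, with $\mathcal N_r(\alpha_i)=\operatorname{span}\{x_i\}$ for all $\tau\ne 0$ and $V^*x_i=0$. There are linearly independent vectors $w_i,z_i$, independent of $\tau$, such that for all $\tau\neq0$ the vector $y_i(\tau)=w_i+\overline\tau z_i$ (so that the row vector $y_i(\tau)^*=w_i^*+\tau z_i^*$ is linear in $\tau$) satisfies $\mathcal N_l(\alpha_i)=\operatorname{span}\{y_i(\tau)\}$ and $U^*y_i(\tau)\neq0$. 2. For each $i=1,\dots,N$ and all $\tau\neq0$, $\beta_i$ is a simple eigenvalue of $\widetilde A-\lambda\widetilde B$. There is a nonzero vector $y_i$, independent of $\tau$, with $\mathcal N_l(\beta_i)=\operatorname{span}\{y_i\}$ for all $\tau\ne 0$ and $U^*y_i=0$. There are linearly independent vectors $w_i,z_i$, independent of $\tau$, such that for all $\tau\neq0$ the vector $x_i(\tau)=w_i+\tau z_i$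 satisfies $\mathcal N_r(\beta_i)=\operatorname{span}\{x_i(\tau)\}$ and $V^*x_i(\tau)\neq0$. 3. For each $i=1,\dots,k$ and all $\tau\neq0$, $\gamma_i$ is an eigenvalue of $\widetilde A-\lambda\widetilde B$ with the same algebraic multiplicity as for $D_A-\lambda D_B$. The spaces $\mathcal N_r(\gamma_i)$ and $\mathcal N_l(\gamma_i)$ do not depend on $\tau\neq0$, and $\mathcal N_r(\gamma_i)\cap\ker V^*=\{0\}$ and $\mathcal N_l(\gamma_i)\cap\ker U^*=\{0\}$. -/

import Mathlib

open Matrix Polynomial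

noncomputable section

/-- The matrix pencil `A - λ B` as a matrix over the polynomial ring `ℂ[λ]`. -/
def pencil {ι : Type*} (A B : Matrix ι ι ℂ) : Matrix ι ι ℂ[X] :=
  A.map C - (X : ℂ[X]) • B.map C

/-- The pencil `A - λ B` is regular if `det (A - λ B)` is not the zero polynomial. -/
def IsRegularPencil {ι : Type*} [Fintype ι] [DecidableEq ι] (A B : Matrix ι ι ℂ) : Prop :=
  (pencil A B).det ≠ 0

/-- The normal rank: the maximum of `rank (A - ζ B)` over `ζ ∈ ℂ`
(the ranks are bounded by the size of the matrices, so the supremum is a maximum). -/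
def nrank {ι : Type*} [Fintype ι] (A B : Matrix ι ι ℂ) : ℕ :=
  ⨆ ζ : ℂ, (A - ζ • B).rank

/-- The pencil at a point of the extended complex plane:
`A - μ B` at a finite `μ`, and `B` at `∞`. -/
def pencilAt {ι : Type*} (A B : Matrix ι ι ℂ) : OnePoint ℂ → Matrix ι ι ℂ
  | OnePoint.infty => B
  | OnePoint.some μ => A - μ • B

/-- `μ ∈ ℂ ∪ {∞}` is an eigenvalue of the (regular or singular) pencil `A - λ B`
if the rank drops below the normal rank at `μ`. -/
def IsPencilEigenvalue {ι : Type*} [Fintype ι] (A B : Matrix ι ι ℂ) (μ : OnePoint ℂ) : Prop :=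
  (pencilAt A B μ).rank < nrank A B

/-- Algebraic multiplicity of `μ ∈ ℂ ∪ {∞}` for a regular pencil: the multiplicity of `μ` as a root
of `det (A - λ B)` if `μ` is finite, and the size minus the degree of `det (A - λ B)` if `μ = ∞`. -/
def algMult {ι : Type*} [Fintype ι] [DecidableEq ι] (A B : Matrix ι ι ℂ) : OnePoint ℂ → ℕ
  | OnePoint.infty => Fintype.card ι - (pencil A B).det.natDegree
  | OnePoint.some μ => (pencil A B).det.rootMultiplicity μ

/-- `μ` is a simple eigenvalue of the regular pencil `A - λ B`. -/
def IsSimpleEigenvalue {ι : Type*} [Fintype ι] [DecidableEq ι] (A B : Matrix ι ι ℂ)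
    (μ : OnePoint ℂ) : Prop :=
  IsRegularPencil A B ∧ IsPencilEigenvalue A B μ ∧ algMult A B μ = 1

/-- The right null space `ker (A - μ B)` (`ker B` if `μ = ∞`). -/
def rightNull {ι : Type*} [Fintype ι] (A B : Matrix ι ι ℂ) (μ : OnePoint ℂ) :
    Submodule ℂ (ι → ℂ) :=
  LinearMap.ker (pencilAt A B μ).mulVecLin

/-- The left null space `ker ((A - μ B)^*)` (`ker (B^*)` if `μ = ∞`). -/
def leftNull {ι : Type*} [Fintype ι] (A B : Matrix ι ι ℂ) (μ : OnePoint ℂ) :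
    Submodule ℂ (ι → ℂ) :=
  LinearMap.ker (pencilAt A B μ)ᴴ.mulVecLin

/-- The `j × (j+1)` matrix `[0 I_j]`, so that `L_j(λ) = [0 I_j] - λ [I_j 0]`. -/
def blockLA (j : ℕ) : Matrix (Fin j) (Fin (j + 1)) ℂ :=
  Matrix.of fun a b => if b = a.succ then 1 else 0

/-- The `j × (j+1)` matrix `[I_j 0]`. -/
def blockLB (j : ℕ) : Matrix (Fin j) (Fin (j + 1)) ℂ :=
  Matrix.of fun a b => if b = a.castSucc then 1 else 0

/-- Row index set of a Kronecker canonical form: regular finite part, regular infinite part,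
blocks `L_{m_i}`, blocks `L_{n_i}^T`. -/
abbrev KRow {p q : ℕ} (r s : ℕ) (right : Fin p → ℕ) (left : Fin q → ℕ) : Type :=
  (Fin r ⊕ Fin s) ⊕ ((Σ i : Fin p, Fin (right i)) ⊕ (Σ i : Fin q, Fin (left i + 1)))

/-- Column index set of a Kronecker canonical form. -/
abbrev KCol {p q : ℕ} (r s : ℕ) (right : Fin p → ℕ) (left : Fin q → ℕ) : Type :=
  (Fin r ⊕ Fin s) ⊕ ((Σ i : Fin p, Fin (right i + 1)) ⊕ (Σ i : Fin q, Fin (left i)))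

/-- The coefficient of `1` in the Kronecker canonical form
`diag (J - λ I, I - λ N, L_{m_1}(λ), …, L_{m_p}(λ), L_{n_1}(λ)^T, …, L_{n_q}(λ)^T)`. -/
def kroneckerA {p q r s : ℕ} (J : Matrix (Fin r) (Fin r) ℂ)
    (right : Fin p → ℕ) (left : Fin q → ℕ) :
    Matrix (KRow r s right left) (KCol r s right left) ℂ :=
  fromBlocks (fromBlocks J 0 0 1) 0 0
    (fromBlocks (blockDiagonal' fun i => blockLA (right i)) 0 0
      (blockDiagonal' fun i => (blockLA (left i))ᵀ))

/-- The coefficient of `-λ` in the Kronecker canonical form. -/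
def kroneckerB {p q r s : ℕ} (N : Matrix (Fin s) (Fin s) ℂ)
    (right : Fin p → ℕ) (left : Fin q → ℕ) :
    Matrix (KRow r s right left) (KCol r s right left) ℂ :=
  fromBlocks (fromBlocks 1 0 0 N) 0 0
    (fromBlocks (blockDiagonal' fun i => blockLB (right i)) 0 0
      (blockDiagonal' fun i => (blockLB (left i))ᵀ))

/-- `A - λ B` has right minimal indices `right` and left minimal indices `left`: these are the
sizes of the singular blocks in a Kronecker canonical form `P (A - λ B) Q` of the pencil.
The matrices `J` and `N` (with `N` nilpotent) may be brought to Jordan form by a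
further similarity, which leaves the singular blocks unchanged, so Jordan form is not demanded.
The bijections `e` and `f` only number the rows and columns of the block matrix. -/
def HasMinimalIndices {n p q : ℕ} (A B : Matrix (Fin n) (Fin n) ℂ)
    (right : Fin p → ℕ) (left : Fin q → ℕ) : Prop :=
  ∃ (r s : ℕ) (J : Matrix (Fin r) (Fin r) ℂ) (N : Matrix (Fin s) (Fin s) ℂ)
    (P Q : Matrix (Fin n) (Fin n) ℂ)
    (e : Fin n ≃ KRow r s right left) (f : Fin n ≃ KCol r s right left),
    IsNilpotent N ∧ IsUnit P ∧ IsUnit Q ∧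
    P * A * Q = (kroneckerA J right left).submatrix e f ∧
    P * B * Q = (kroneckerB N right left).submatrix e f

/-- A subset of `ℂ^σ` is algebraic if it is the set of common zeros of finitely many
polynomials. -/
def IsAlgebraicSet {σ : Type*} (S : Set (σ → ℂ)) : Prop :=
  ∃ F : Finset (MvPolynomial σ ℂ), S = {z | ∀ p ∈ F, MvPolynomial.eval z p = 0}

/-- A subset of `ℂ^σ` is generic if its complement lies in a proper algebraic set. -/
def IsGenericSet {σ : Type*} (Ω : Set (σ → ℂ)) : Prop :=
  ∃ S : Set (σ → ℂ), IsAlgebraicSet S ∧ S ≠ Set.univ ∧ Ωᶜ ⊆ S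

/-- The point of `ℂ^{2nk}` whose coordinates are the entries of `U` and of `W`. -/
def entries {n k : ℕ} (U : Matrix (Fin n) (Fin k) ℂ) (W : Matrix (Fin k) (Fin n) ℂ) :
    (Fin n × Fin k) ⊕ (Fin k × Fin n) → ℂ :=
  Sum.elim (fun ij => U ij.1 ij.2) (fun ij => W ij.1 ij.2)

/-- A property of `(U, V)` holds generically with respect to the entries of `U` and `V^*`. -/
def HoldsGenerically {n k : ℕ}
    (Pr : Matrix (Fin n) (Fin k) ℂ → Matrix (Fin n) (Fin k) ℂ → Prop) : Prop :=
  ∃ Ω : Set ((Fin n × Fin k) ⊕ (Fin k × Fin n) → ℂ),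
    IsGenericSet Ω ∧ ∀ U V : Matrix (Fin n) (Fin k) ℂ, entries U Vᴴ ∈ Ω → Pr U V

/-- The value `a / b ∈ ℂ ∪ {∞}`, interpreted as `∞` if `b = 0`. -/
def extendedQuotient (a b : ℂ) : OnePoint ℂ :=
  if b = 0 then OnePoint.infty else ((a / b : ℂ) : OnePoint ℂ)

/-- The perturbed coefficient `A + τ U diag(d) V^*`. -/
def perturb {n k : ℕ} (A : Matrix (Fin n) (Fin n) ℂ) (U V : Matrix (Fin n) (Fin k) ℂ)
    (d : Fin k → ℂ) (τ : ℂ) : Matrix (Fin n) (Fin n) ℂ :=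
  A + τ • (U * diagonal d * Vᴴ)

end

/-! Write `S(λ) = A - λB` and `D(λ) = D_A - λD_B`. The Kronecker form gives polynomial bases `X(λ)`
(columns) and `Y(λ)` (rows) of the right and left null spaces of `S(λ)`, whose degrees are the
minimal indices. Everything follows from one identity, with `χ` the determinant of the regular part
and `c ≠ 0` a constant: `det (S + τ U D V*) = c τ^k χ · det D · q · p`, where `q = det (Y U)` and `p
= det (V* X)`.

The parameter `τ` enters only through a nonzero scalar, so the eigenvalues do not move with it.
Since `deg p ≤ M` and `deg q ≤ N`, generically `p q` has exactly `M + N` zeros, all simple and away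
from those of `χ · det D`: the `α_i` are the zeros of `p`, the `β_i` those of `q`. Genericity holds
because leading coefficient, discriminant and values at forbidden points are polynomial in `(U, V*)`
and are nonzero together at an explicit diagonal example.

At a zero of `p` some `x = X c ≠ 0` has `V* x = 0`; it lies in the kernel for every `τ`. The left
null vector comes from solving one linear system, possible because the left and right null spaces of
`S` have dimension `k`; it is affine in the conjugate of `τ`. Zeros of `q` are the adjoint case. At
`γ_i` neither `p` nor `q` vanishes (at infinity, neither do their leading coefficient determinants),
so multiplying by `Y` splits the kernel equation into `S x = 0` and `D V* x = 0`, in which `τ` is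
absent.

The carrying lemmas are `det_add_mul_mul_of_rank_form`, `exists_kernelData`,
`KernelData.holdsGenerically_isGood`, `null_spaces_of_det_eq_zero` and `null_spaces_of_det_ne_zero`.
-/

/-! ### Unimodular factorization of the singular blocks and their polynomial kernels. -/

/-- Column `i` holds the powers `1, X, …, X ^ m i` on the `i`-th block. -/
noncomputable def vander {k : ℕ} (m : Fin k → ℕ) :
    Matrix (Σ i : Fin k, Fin (m i + 1)) (Fin k) ℂ[X] :=
  Matrix.of fun a i => if a.1 = i then X ^ (a.2 : ℕ) else 0

/-- The leading coefficients of `vander m`: column `i` is the last unit vector of block `i`. -/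
def lastUnit {k : ℕ} (m : Fin k → ℕ) : Matrix (Σ i : Fin k, Fin (m i + 1)) (Fin k) ℂ :=
  Matrix.of fun a i => if a.1 = i ∧ (a.2 : ℕ) = m a.1 then 1 else 0

/-- The selector of the zeroth entry of every block. -/
def zerothUnit {k : ℕ} (R : Type*) [Zero R] [One R] (m : Fin k → ℕ) :
    Matrix (Σ i : Fin k, Fin (m i + 1)) (Fin k) R :=
  Matrix.of fun a i => if a = ⟨i, 0⟩ then 1 else 0

/-- The unimodular bidiagonal matrix that extends `L_m` by the zeroth unit row. -/
noncomputable def bidiag (m : ℕ) : Matrix (Fin (m + 1)) (Fin (m + 1)) ℂ[X] :=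
  Matrix.of fun a b => if a = b then 1 else if (a : ℕ) = b + 1 then -X else 0

theorem det_bidiag (m : ℕ) : (bidiag m).det = 1 := by
  rw [Matrix.det_of_isLowerTriangular]
  · simp [bidiag]
  · intro i j hij
    have h : i < j := hij
    have h1 : i ≠ j := h.ne
    have h2 : (i : ℕ) ≠ j + 1 := by have : (i : ℕ) < j := h; omega
    simp [bidiag, h1, h2]

/-- The rows of the identity matrix other than the zeroth. -/
def succRows (R : Type*) [Zero R] [One R] (m : ℕ) : Matrix (Fin m) (Fin (m + 1)) R :=
  (1 : Matrix (Fin (m + 1)) (Fin (m + 1)) R).submatrix Fin.succ id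

/-- Over `ℂ[X]` the block `L_m` thus becomes the constant matrix `[0 I]` after a unimodular column
operation. -/
theorem block_pencil (m : ℕ) :
    (blockLA m).map C - (X : ℂ[X]) • (blockLB m).map C = succRows ℂ[X] m * bidiag m := by
  have : succRows ℂ[X] m * bidiag m = (bidiag m).submatrix Fin.succ id := by
    change ((1 : Matrix _ _ ℂ[X]) * bidiag m).submatrix Fin.succ id = _
    rw [Matrix.one_mul]
  rw [this]
  ext1 a b
  have h1 : (b = a.succ) ↔ (a.succ = b) := eq_comm
  have h2 : (b = a.castSucc) ↔ (((a.succ : Fin (m + 1)) : ℕ) = b + 1) := by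
    simp [Fin.ext_iff, eq_comm]
  simp only [blockLA, blockLB, bidiag, Matrix.sub_apply, Matrix.map_apply, Matrix.smul_apply,
    Matrix.of_apply, Matrix.submatrix_apply, id, h1, h2]
  by_cases h : a.succ = b
  · subst h; simp
  · simp only [h, if_false]
    split_ifs <;> simp

/-- Each row after the zeroth cancels, `X^a - X · X^(a-1) = 0`. -/
theorem bidiag_mulVec_pow (m : ℕ) (a : Fin (m + 1)) :
    ∑ b, bidiag m a b * X ^ (b : ℕ) = if a = 0 then 1 else 0 := by
  refine Fin.cases ?_ (fun a => ?_) a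
  · rw [Finset.sum_eq_single 0]
    · simp [bidiag]
    · intro b _ hb
      have : (0 : Fin (m + 1)) ≠ b := hb.symm
      simp [bidiag, this]
    · simp
  · have hne : a.castSucc ≠ a.succ := (Fin.castSucc_lt_succ).ne
    rw [Finset.sum_eq_add_of_mem a.castSucc a.succ (Finset.mem_univ _) (Finset.mem_univ _) hne]
    · simp [bidiag, hne.symm, pow_succ']
    · rintro b - ⟨h1, h2⟩
      have h3 : ¬ (a.succ = b) := fun h => h2 h.symm
      have h4 : ¬ ((a.succ : ℕ) = b + 1) := by
        intro h; apply h1; ext; simp at h ⊢; omega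
      simp [bidiag, h3] 
      intro h; simp at h4; exact absurd h h4

/-- The zeroth unit vectors span the kernel of the `succRows` blocks, so this identifies the columns
of `vander` as a kernel basis of the `L` blocks. -/
theorem blockDiagonal'_bidiag_mul_vander {k : ℕ} (m : Fin k → ℕ) :
    (blockDiagonal' fun i => bidiag (m i)) * vander m = zerothUnit ℂ[X] m := by
  ext1 ⟨i, a⟩ l
  rw [Matrix.mul_apply, Fintype.sum_sigma, Finset.sum_eq_single i]
  · simp only [blockDiagonal'_apply_eq, vander, Matrix.of_apply, zerothUnit]
    by_cases h : i = l
    · subst h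
      simp only [if_true, bidiag_mulVec_pow]
      simp
    · simp only [h, if_false, mul_zero, Finset.sum_const_zero]
      refine (if_neg fun h' => h ?_).symm
      exact congrArg Sigma.fst h'
  · intro j _ hj
    simp [blockDiagonal'_apply_ne _ _ _ hj.symm]
  · simp

theorem isUnit_det_blockDiagonal'_bidiag {k : ℕ} (m : Fin k → ℕ) :
    IsUnit (blockDiagonal' fun i => bidiag (m i)).det := by
  have h : (blockDiagonal' fun i => bidiag (m i)) * (blockDiagonal' fun i => (bidiag (m i))⁻¹)
      = 1 := by
    rw [← blockDiagonal'_mul]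
    have h1 : ∀ i, bidiag (m i) * (bidiag (m i))⁻¹ = 1 := fun i =>
      Matrix.mul_nonsing_inv _ (by rw [det_bidiag]; exact isUnit_one)
    simp only [h1]
    exact blockDiagonal'_one
  have := congrArg Matrix.det h
  rw [Matrix.det_mul, Matrix.det_one] at this
  exact IsUnit.of_mul_eq_one _ this

/-- The counterpart at infinity: the leading coefficients of the kernel polynomials are killed by
`[I 0]`. -/
theorem blockLB_mul_lastUnit {k : ℕ} (m : Fin k → ℕ) :
    (blockDiagonal' fun i => blockLB (m i)) * lastUnit m = 0 := by
  ext1 ⟨i, a⟩ l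
  rw [Matrix.mul_apply, Fintype.sum_sigma]
  refine Finset.sum_eq_zero fun j _ => Finset.sum_eq_zero fun b _ => ?_
  by_cases h : i = j
  · subst h
    rw [blockDiagonal'_apply_eq]
    simp only [blockLB, lastUnit, Matrix.of_apply]
    split_ifs with h1 h2
    · subst h1
      have := a.2
      simp at h2
      omega
    all_goals simp
  · rw [blockDiagonal'_apply_ne _ _ _ h, zero_mul]

/-! ### Determinant of a perturbation of a matrix in rank normal form. -/

theorem det_submatrix_equiv {R ι κ : Type*} [CommRing R] [Fintype ι] [DecidableEq ι] [Fintype κ]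
    [DecidableEq κ] (e f : κ ≃ ι) (M : Matrix ι ι R) :
    (M.submatrix e f).det = ((Equiv.Perm.sign (f.trans e.symm) : ℤ) : R) * M.det := by
  have : M.submatrix e f = (M.submatrix e e).submatrix id (f.trans e.symm) := by
    ext; simp
  rw [this, Matrix.det_permute', Matrix.det_submatrix_equiv_self]

/-- After removing `P` and `Q`, only the last block of rows of `P⁻¹U` and the last block of columns
of `VQ⁻¹` reach the determinant, and these blocks are `Y U` and `V X`. No invertibility of `G` or
`D` is needed, so the identity applies directly over `ℂ[X]`. -/
theorem det_add_mul_mul_of_rank_form {R ι κ o : Type*} [CommRing R] [Fintype ι] [DecidableEq ι]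
    [Fintype κ] [DecidableEq κ] [Fintype o] [DecidableEq o]
    {S P Q : Matrix κ κ R} {G : Matrix ι ι R} (e f : κ ≃ ι ⊕ o)
    (hS : S = P * (fromBlocks G 0 0 0).submatrix e f * Q)
    (hP : IsUnit P.det) (hQ : IsUnit Q.det) {X : Matrix κ o R} {Y : Matrix o κ R}
    (hY : Y * P = (fromCols 0 1).submatrix id e) (hX : Q * X = (fromRows 0 1).submatrix f id)
    (U : Matrix κ o R) (D : Matrix o o R) (V : Matrix o κ R) :
    (S + U * D * V).det = P.det * Q.det * ((Equiv.Perm.sign (f.trans e.symm) : ℤ) : R) *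
      (G.det * (Y * U).det * D.det * (V * X).det) := by
  set U' : Matrix (ι ⊕ o) o R := (P⁻¹ * U).submatrix e.symm id with hU'
  set V' : Matrix o (ι ⊕ o) R := (V * Q⁻¹).submatrix id f.symm with hV'
  have hU : U = P * U'.submatrix e id := by
    rw [hU', Matrix.submatrix_submatrix]; simp [Matrix.mul_nonsing_inv_cancel_left _ _ hP]
  have hV : V = V'.submatrix id f * Q := by
    rw [hV', Matrix.submatrix_submatrix]; simp [Matrix.nonsing_inv_mul_cancel_right _ _ hQ]
  have hYU : Y * U = U'.toRows₂ := by
    rw [hU, ← Matrix.mul_assoc, hY, Matrix.submatrix_mul_equiv]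
    conv_lhs => rw [← Matrix.fromRows_toRows U', Matrix.fromCols_mul_fromRows]
    simp
  have hVX : V * X = V'.toCols₂ := by
    rw [hV, Matrix.mul_assoc, hX, Matrix.submatrix_mul_equiv]
    conv_lhs => rw [← Matrix.fromCols_toCols V', Matrix.fromCols_mul_fromRows]
    simp
  -- A product of a block upper and a block lower triangular matrix, so its determinant can be read
  -- off.
  have key : fromBlocks G 0 0 0 + U' * D * V' =
      fromBlocks 1 U'.toRows₁ 0 U'.toRows₂ * fromBlocks G 0 (D * V'.toCols₁) (D * V'.toCols₂) := by
    conv_lhs => rw [← Matrix.fromRows_toRows U', ← Matrix.fromCols_toCols V']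
    rw [Matrix.fromBlocks_multiply, Matrix.mul_assoc, Matrix.mul_fromCols,
      Matrix.fromRows_mul_fromCols, Matrix.fromBlocks_add]
    simp
  have h : S + U * D * V = P * (fromBlocks G 0 0 0 + U' * D * V').submatrix e f * Q := by
    rw [hS]
    conv_lhs => rw [hU, hV]
    have : (U' * D * V').submatrix e f = U'.submatrix e id * D * V'.submatrix id f := rfl
    rw [Matrix.submatrix_add, Pi.add_apply, Pi.add_apply, this]
    simp only [Matrix.mul_add, Matrix.add_mul, Matrix.mul_assoc]
  rw [h, Matrix.det_mul, Matrix.det_mul, det_submatrix_equiv, key, Matrix.det_mul,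
    Matrix.det_fromBlocks_zero₂₁, Matrix.det_fromBlocks_zero₁₂, Matrix.det_one, Matrix.det_mul,
    ← hYU, ← hVX]
  ring

/-! ### Reduction of the Kronecker form to rank normal form. -/

/-- Split the zeroth index off every block. -/
def splitSigma {k : ℕ} (m : Fin k → ℕ) :
    (Σ i : Fin k, Fin (m i + 1)) ≃ (Σ i : Fin k, Fin (m i)) ⊕ Fin k where
  toFun a := Fin.cases (Sum.inr a.1) (fun j => Sum.inl ⟨a.1, j⟩) a.2
  invFun := Sum.elim (fun a => ⟨a.1, a.2.succ⟩) (fun i => ⟨i, 0⟩)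
  left_inv := by
    rintro ⟨i, j⟩
    refine Fin.cases ?_ (fun j => ?_) j <;> rfl
  right_inv := by
    rintro (⟨i, j⟩ | i) <;> rfl

/-- The index type of the invertible part of a Kronecker canonical form. -/
abbrev KCore {k : ℕ} (r s : ℕ) (right left : Fin k → ℕ) : Type :=
  (Fin r ⊕ Fin s) ⊕ ((Σ i : Fin k, Fin (right i)) ⊕ (Σ i : Fin k, Fin (left i)))

/-- Number the rows so that the zero block of the stripped form comes last. -/
def rowEquiv {k : ℕ} (r s : ℕ) (right left : Fin k → ℕ) :
    KRow r s right left ≃ KCore r s right left ⊕ Fin k :=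
  ((Equiv.refl _).sumCongr (((Equiv.refl _).sumCongr (splitSigma left)).trans
    (Equiv.sumAssoc _ _ _).symm)).trans (Equiv.sumAssoc _ _ _).symm

/-- Number the columns so that the zero block of the stripped form comes last. -/
def colEquiv {k : ℕ} (r s : ℕ) (right left : Fin k → ℕ) :
    KCol r s right left ≃ KCore r s right left ⊕ Fin k :=
  ((Equiv.refl _).sumCongr (((splitSigma right).sumCongr (Equiv.refl _)).trans
    (((Equiv.sumAssoc _ _ _).trans ((Equiv.refl _).sumCongr (Equiv.sumComm _ _))).trans
    (Equiv.sumAssoc _ _ _).symm))).trans (Equiv.sumAssoc _ _ _).symm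

/-- A Kronecker canonical form, stripped of its unimodular factors. -/
noncomputable def kroneckerCore {k r s : ℕ} (R : Matrix (Fin r ⊕ Fin s) (Fin r ⊕ Fin s) ℂ[X])
    (right left : Fin k → ℕ) : Matrix (KRow r s right left) (KCol r s right left) ℂ[X] :=
  fromBlocks R 0 0 (fromBlocks (blockDiagonal' fun i => succRows ℂ[X] (right i)) 0 0
    (blockDiagonal' fun i => (succRows ℂ[X] (left i))ᵀ))

theorem blockDiagonal'_succRows {k : ℕ} (m : Fin k → ℕ) :
    (blockDiagonal' fun i => succRows ℂ[X] (m i)) =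
      (fromCols 1 0 : Matrix _ ((Σ i : Fin k, Fin (m i)) ⊕ Fin k) ℂ[X]).submatrix id
        (splitSigma m) := by
  ext1 ⟨i, a⟩ b
  obtain ⟨b, rfl⟩ := (splitSigma m).symm.surjective b
  rw [Matrix.submatrix_apply, Equiv.apply_symm_apply]
  rcases b with ⟨j, b⟩ | j
  · change blockDiagonal' (fun i => succRows ℂ[X] (m i)) ⟨i, a⟩ ⟨j, b.succ⟩ = _
    by_cases h : i = j
    · subst h
      rw [blockDiagonal'_apply_eq]
      simp [succRows, Matrix.one_apply]
    · rw [blockDiagonal'_apply_ne _ _ _ h]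
      have : (⟨i, a⟩ : Σ i : Fin k, Fin (m i)) ≠ ⟨j, b⟩ := fun h' => h (congrArg Sigma.fst h')
      simp [this]
  · change blockDiagonal' (fun i => succRows ℂ[X] (m i)) ⟨i, a⟩ ⟨j, 0⟩ = _
    by_cases h : i = j
    · subst h
      rw [blockDiagonal'_apply_eq]
      simp [succRows]
    · rw [blockDiagonal'_apply_ne _ _ _ h]
      simp

/-- Each right block has one zero column and each left block one zero row; once these `k` columns
and `k` rows are numbered last, the rest is the regular part and an identity. -/
theorem kroneckerCore_eq {k r s : ℕ} (R : Matrix (Fin r ⊕ Fin s) (Fin r ⊕ Fin s) ℂ[X])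
    (right left : Fin k → ℕ) :
    kroneckerCore R right left = (fromBlocks (fromBlocks R 0 0 1) 0 0 0 :
      Matrix (KCore r s right left ⊕ Fin k) (KCore r s right left ⊕ Fin k) ℂ[X]).submatrix
      (rowEquiv r s right left) (colEquiv r s right left) := by
  have hT : (blockDiagonal' fun i => (succRows ℂ[X] (left i))ᵀ) =
      (fromRows 1 0 : Matrix ((Σ i : Fin k, Fin (left i)) ⊕ Fin k) _ ℂ[X]).submatrix
        (splitSigma left) id := by
    rw [← blockDiagonal'_transpose, blockDiagonal'_succRows]
    ext a b
    simp only [Matrix.transpose_apply, Matrix.submatrix_apply]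
    rcases splitSigma left a with c | c <;> simp [Matrix.one_apply, eq_comm]
  rw [kroneckerCore, hT, blockDiagonal'_succRows]
  ext1 x y
  rcases x with x | x | x
  · rcases y with y | y | y
    · rfl
    · simp only [rowEquiv, colEquiv, Matrix.submatrix_apply]
      rcases h : splitSigma right y with c | c <;> simp [h]
    · rfl
  · rcases y with y | y | y
    · rfl
    · simp only [rowEquiv, colEquiv, Matrix.submatrix_apply]
      rcases h : splitSigma right y with c | c <;> simp [h, Matrix.one_apply]
    · rfl
  · rcases y with y | y | y
    · simp only [rowEquiv, colEquiv, Matrix.submatrix_apply]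
      rcases h : splitSigma left x with c | c <;> simp [h]
    · simp only [rowEquiv, colEquiv, Matrix.submatrix_apply]
      rcases h : splitSigma left x with c | c <;> rcases h' : splitSigma right y with d | d <;>
        simp [h, h']
    · simp only [rowEquiv, colEquiv, Matrix.submatrix_apply]
      rcases h : splitSigma left x with c | c <;> simp [h, Matrix.one_apply]

/-- The regular part of a Kronecker canonical form. -/
noncomputable def regularPart {r s : ℕ} (J : Matrix (Fin r) (Fin r) ℂ)
    (N : Matrix (Fin s) (Fin s) ℂ) : Matrix (Fin r ⊕ Fin s) (Fin r ⊕ Fin s) ℂ[X] :=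
  pencil (fromBlocks J 0 0 1) (fromBlocks 1 0 0 N)

/-- The unimodular left factor of a Kronecker canonical form. -/
noncomputable def leftFactor {k : ℕ} (r s : ℕ) (right left : Fin k → ℕ) :
    Matrix (KRow r s right left) (KRow r s right left) ℂ[X] :=
  fromBlocks 1 0 0 (fromBlocks 1 0 0 (blockDiagonal' fun i => bidiag (left i))ᵀ)

/-- The unimodular right factor of a Kronecker canonical form. -/
noncomputable def rightFactor {k : ℕ} (r s : ℕ) (right left : Fin k → ℕ) :
    Matrix (KCol r s right left) (KCol r s right left) ℂ[X] :=
  fromBlocks 1 0 0 (fromBlocks (blockDiagonal' fun i => bidiag (right i)) 0 0 1)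

theorem isUnit_det_leftFactor {k : ℕ} (r s : ℕ) (right left : Fin k → ℕ) :
    IsUnit (leftFactor r s right left).det := by
  rw [leftFactor, det_fromBlocks_zero₂₁, det_fromBlocks_zero₂₁, det_one, det_one, one_mul,
    one_mul, det_transpose]
  exact isUnit_det_blockDiagonal'_bidiag left

theorem isUnit_det_rightFactor {k : ℕ} (r s : ℕ) (right left : Fin k → ℕ) :
    IsUnit (rightFactor r s right left).det := by
  rw [rightFactor, det_fromBlocks_zero₂₁, det_fromBlocks_zero₂₁, det_one, det_one, one_mul,
    mul_one]
  exact isUnit_det_blockDiagonal'_bidiag right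

theorem map_blockDiagonal'_sub_smul {k : ℕ} {m n : Fin k → ℕ}
    (M N : ∀ i, Matrix (Fin (m i)) (Fin (n i)) ℂ) :
    (blockDiagonal' M).map C - (X : ℂ[X]) • (blockDiagonal' N).map C =
      blockDiagonal' fun i => (M i).map C - (X : ℂ[X]) • (N i).map C := by
  rw [blockDiagonal'_map _ _ (map_zero C), blockDiagonal'_map _ _ (map_zero C),
    ← blockDiagonal'_smul, ← blockDiagonal'_sub]
  rfl

theorem fromBlocks_sub_fromBlocks {a b c d R : Type*} [AddGroup R] (A A' : Matrix a c R)
    (B B' : Matrix a d R) (C C' : Matrix b c R) (D D' : Matrix b d R) :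
    fromBlocks A B C D - fromBlocks A' B' C' D' =
      fromBlocks (A - A') (B - B') (C - C') (D - D') := by
  ext1 x y
  rcases x with x | x <;> rcases y with y | y <;> simp

/-- Right blocks take their unimodular factor from the right and left blocks, by transposition, from
the left; the two kinds of factor act on different blocks and do not interfere. -/
theorem kronecker_factorization {k r s : ℕ} (J : Matrix (Fin r) (Fin r) ℂ)
    (N : Matrix (Fin s) (Fin s) ℂ) (right left : Fin k → ℕ) :
    (kroneckerA J right left).map C - (X : ℂ[X]) • (kroneckerB N right left).map C =
      leftFactor r s right left * kroneckerCore (regularPart J N) right left *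
        rightFactor r s right left := by
  have h0 : ∀ {a b : Type} [Fintype a] [Fintype b],
      (0 : Matrix a b ℂ).map (C : ℂ →+* ℂ[X]) = 0 := fun {a b} _ _ => by ext1; simp
  have hL : (blockDiagonal' fun i => (blockLA (left i))ᵀ).map C -
      (X : ℂ[X]) • (blockDiagonal' fun i => (blockLB (left i))ᵀ).map C =
      (blockDiagonal' fun i => bidiag (left i))ᵀ *
        blockDiagonal' fun i => (succRows ℂ[X] (left i))ᵀ := by
    rw [blockDiagonal'_transpose, ← blockDiagonal'_mul, map_blockDiagonal'_sub_smul]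
    congr 1
    funext i
    rw [← Matrix.transpose_mul, ← block_pencil]
    rfl
  have hR : (blockDiagonal' fun i => blockLA (right i)).map C -
      (X : ℂ[X]) • (blockDiagonal' fun i => blockLB (right i)).map C =
      (blockDiagonal' fun i => succRows ℂ[X] (right i)) *
        blockDiagonal' fun i => bidiag (right i) := by
    rw [← blockDiagonal'_mul, map_blockDiagonal'_sub_smul]
    congr 1
    funext i
    rw [← block_pencil]
  rw [kroneckerA, kroneckerB, leftFactor, rightFactor, kroneckerCore]
  simp only [fromBlocks_multiply, Matrix.mul_zero, Matrix.zero_mul, add_zero, zero_add,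
    Matrix.one_mul, Matrix.mul_one]
  rw [← hL, ← hR, regularPart, pencil]
  simp only [fromBlocks_map, fromBlocks_smul, fromBlocks_sub_fromBlocks, h0, smul_zero,
    sub_zero]

/-! ### Rank and determinant estimates. -/

theorem matrix_rank_add_le {K m n : Type*} [Field K] [Fintype m] [Fintype n] (A B : Matrix m n K) :
    (A + B).rank ≤ A.rank + B.rank := by
  rw [Matrix.rank, Matrix.rank, Matrix.rank, Matrix.mulVecLin_add]
  exact (Submodule.finrank_mono (LinearMap.range_add_le _ _)).trans
    (Submodule.finrank_add_le_finrank_add_finrank _ _)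

theorem rank_fromBlocks_diag_le {K a b c d : Type*} [Field K] [Fintype a] [Fintype b] [Fintype c]
    [Fintype d] (M : Matrix a c K) (N : Matrix b d K) :
    (fromBlocks M 0 0 N).rank ≤ M.rank + N.rank := by
  classical
  have h : fromBlocks M 0 0 N = (fromRows 1 0 : Matrix (a ⊕ b) a K) * M *
      (fromCols 1 0 : Matrix c (c ⊕ d) K) + (fromRows 0 1 : Matrix (a ⊕ b) b K) * N *
      (fromCols 0 1 : Matrix d (c ⊕ d) K) := by
    simp only [fromRows_mul, Matrix.mul_fromCols, Matrix.one_mul, Matrix.zero_mul, Matrix.mul_one,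
      Matrix.mul_zero]
    ext1 x y
    rcases x with x | x <;> rcases y with y | y <;> simp
  rw [h]
  refine (matrix_rank_add_le _ _).trans (add_le_add ?_ ?_)
  · exact (rank_mul_le_left _ _).trans (rank_mul_le_right _ _)
  · exact (rank_mul_le_left _ _).trans (rank_mul_le_right _ _)

theorem det_ne_zero_of_card_le_rank {K a : Type*} [Field K] [Fintype a] [DecidableEq a]
    {M : Matrix a a K} (h : Fintype.card a ≤ M.rank) : M.det ≠ 0 := by
  have hr : LinearMap.range M.mulVecLin = ⊤ := by
    apply Submodule.eq_top_of_finrank_eq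
    rw [Module.finrank_fintype_fun_eq_card]
    exact le_antisymm M.rank_le_card_height h
  have : Function.Surjective M.mulVec := LinearMap.range_eq_top.mp hr
  rw [Matrix.mulVec_surjective_iff_isUnit, Matrix.isUnit_iff_isUnit_det] at this
  exact this.ne_zero

theorem eval_det_pencil {ι : Type*} [Fintype ι] [DecidableEq ι] (A B : Matrix ι ι ℂ) (z : ℂ) :
    (pencil A B).det.eval z = (A - z • B).det := by
  rw [← coe_evalRingHom, RingHom.map_det]
  congr 1
  ext i j
  simp [pencil]
  ring

theorem natDegree_det_pencil {ι : Type*} [Fintype ι] [DecidableEq ι] (A B : Matrix ι ι ℂ)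
    (hB : B.det ≠ 0) : (pencil A B).det.natDegree = Fintype.card ι := by
  have h : pencil A B = (X : ℂ[X]) • (-B).map C + A.map C := by
    ext1 i j
    simp [pencil]
    ring
  rw [h]
  refine le_antisymm (natDegree_det_X_add_C_le _ _) (le_natDegree_of_ne_zero ?_)
  rw [coeff_det_X_add_C_card, det_neg]
  exact mul_ne_zero (pow_ne_zero _ (by norm_num)) hB

theorem zerothUnit_eq {k : ℕ} (R : Type*) [Zero R] [One R] (m : Fin k → ℕ) :
    zerothUnit R m = (fromRows 0 1 :
      Matrix ((Σ i : Fin k, Fin (m i)) ⊕ Fin k) (Fin k) R).submatrix (splitSigma m) id := by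
  ext1 x l
  obtain ⟨x, rfl⟩ := (splitSigma m).symm.surjective x
  rw [Matrix.submatrix_apply, Equiv.apply_symm_apply]
  have : (⟨l, 0⟩ : Σ i : Fin k, Fin (m i + 1)) = (splitSigma m).symm (Sum.inr l) := rfl
  simp only [zerothUnit, Matrix.of_apply, this, EmbeddingLike.apply_eq_iff_eq]
  rcases x with x | x <;> simp [Matrix.one_apply]

/-! ### Polynomial null space bases extracted from the Kronecker form. -/

/-- Polynomial bases of the right and left null spaces of a singular pencil, together with the
resulting formula for the determinant of a perturbation. -/
structure KernelData {n k : ℕ} (A B : Matrix (Fin n) (Fin n) ℂ) (right left : Fin k → ℕ) where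
  χ : ℂ[X]
  c : ℂ
  T : Matrix (Fin n) (Σ i : Fin k, Fin (right i + 1)) ℂ
  T' : Matrix (Σ i : Fin k, Fin (right i + 1)) (Fin n) ℂ
  L : Matrix (Σ i : Fin k, Fin (left i + 1)) (Fin n) ℂ
  L' : Matrix (Fin n) (Σ i : Fin k, Fin (left i + 1)) ℂ
  c_ne_zero : c ≠ 0
  T'_mul_T : T' * T = 1
  L_mul_L' : L * L' = 1
  pencil_mul : pencil A B * (T.map C * vander right) = 0
  mul_pencil : ((vander left)ᵀ * L.map C) * pencil A B = 0
  mul_lastUnit : B * (T * lastUnit right) = 0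
  lastUnit_mul : (lastUnit left)ᵀ * L * B = 0
  det_eq : ∀ (U : Matrix (Fin n) (Fin k) ℂ[X]) (D : Matrix (Fin k) (Fin k) ℂ[X])
    (V : Matrix (Fin k) (Fin n) ℂ[X]), (pencil A B + U * D * V).det =
      C c * (χ * ((vander left)ᵀ * L.map C * U).det * D.det * (V * (T.map C * vander right)).det)
  eval_ne_zero : ∀ z : ℂ, n ≤ (A - z • B).rank + k → χ.eval z ≠ 0
  natDegree_eq : n ≤ B.rank + k → χ.natDegree + (∑ i, right i) + (∑ i, left i) + k = n

/-- The singular blocks contribute at most `M + N`, so a matrix of rank at least `n - k` must have a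
regular part of full rank. -/
theorem rank_le_of_regular_blocks {k r s : ℕ} (right left : Fin k → ℕ)
    (R : Matrix (Fin r ⊕ Fin s) (Fin r ⊕ Fin s) ℂ)
    (M : Matrix (Σ i : Fin k, Fin (right i)) (Σ i : Fin k, Fin (right i + 1)) ℂ)
    (N : Matrix (Σ i : Fin k, Fin (left i + 1)) (Σ i : Fin k, Fin (left i)) ℂ) :
    (fromBlocks R 0 0 (fromBlocks M 0 0 N)).rank ≤ R.rank + ((∑ i, right i) + ∑ i, left i) := by
  have hM : M.rank ≤ ∑ i, right i := by simpa using M.rank_le_card_height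
  have hN : N.rank ≤ ∑ i, left i := by simpa using N.rank_le_card_width
  have h1 := rank_fromBlocks_diag_le R (fromBlocks M 0 0 N)
  have h2 := rank_fromBlocks_diag_le M N
  omega

/-- Here `χ` is the determinant of the regular part, `T` consists of the columns of `Q` and `L` of
the rows of `P` that belong to the right and left singular blocks. Being parts of invertible
matrices, they have the one-sided inverses `T'` and `L'`. -/
theorem exists_kernelData {n k : ℕ} {A B : Matrix (Fin n) (Fin n) ℂ} {right left : Fin k → ℕ}
    (h : HasMinimalIndices A B right left) : Nonempty (KernelData A B right left) := by
  obtain ⟨r, s, J, N, P, Q, e, f, -, hP, hQ, hA, hB⟩ := h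
  have hcard : n = (r + s) + ((∑ i, right i) + ∑ i, left i) + k := by
    have := Fintype.card_congr e
    simp [Finset.sum_add_distrib] at this
    omega
  have hPd : IsUnit P.det := (Matrix.isUnit_iff_isUnit_det _).mp hP
  have hQd : IsUnit Q.det := (Matrix.isUnit_iff_isUnit_det _).mp hQ
  have hmap : ∀ {a b c : Type} [Fintype b] (M : Matrix a b ℂ) (N : Matrix b c ℂ),
      (M * N).map (C : ℂ →+* ℂ[X]) = M.map C * N.map C := fun M N => Matrix.map_mul
  have hone : ∀ {a : Type} [DecidableEq a], (1 : Matrix a a ℂ).map (C : ℂ →+* ℂ[X]) = 1 :=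
    fun {a} _ => Matrix.map_one _ (map_zero C) (map_one C)
  set g : (Σ i : Fin k, Fin (right i + 1)) → KCol r s right left := fun a => Sum.inr (Sum.inl a)
    with hg
  set g' : (Σ i : Fin k, Fin (left i + 1)) → KRow r s right left := fun a => Sum.inr (Sum.inr a)
    with hg'
  set e' := e.trans (rowEquiv r s right left) with he'
  set f' := f.trans (colEquiv r s right left) with hf'
  set G : Matrix (KCore r s right left) (KCore r s right left) ℂ[X] :=
    fromBlocks (regularPart J N) 0 0 1 with hG
  set PL := (P⁻¹).map C * (leftFactor r s right left).submatrix e e with hPL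
  set QR := (rightFactor r s right left).submatrix f f * (Q⁻¹).map C with hQR
  have hPP : P.map C * (P⁻¹).map C = 1 := by rw [← hmap, Matrix.mul_nonsing_inv _ hPd, hone]
  have hPP' : (P⁻¹).map C * P.map C = 1 := by rw [← hmap, Matrix.nonsing_inv_mul _ hPd, hone]
  have hQQ : Q.map C * (Q⁻¹).map C = 1 := by rw [← hmap, Matrix.mul_nonsing_inv _ hQd, hone]
  have hQQ' : (Q⁻¹).map C * Q.map C = 1 := by rw [← hmap, Matrix.nonsing_inv_mul _ hQd, hone]
  have hpen : P.map C * pencil A B * Q.map C =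
      (leftFactor r s right left * kroneckerCore (regularPart J N) right left *
        rightFactor r s right left).submatrix e f := by
    rw [← kronecker_factorization, pencil, Matrix.mul_sub, Matrix.sub_mul, Matrix.mul_smul,
      Matrix.smul_mul, ← hmap, ← hmap, ← hmap, ← hmap, hA, hB]
    rfl
  have hS : pencil A B = PL * (fromBlocks G 0 0 0).submatrix e' f' * QR := by
    have h1 : (fromBlocks G 0 0 0 : Matrix (KCore r s right left ⊕ Fin k)
        (KCore r s right left ⊕ Fin k) ℂ[X]).submatrix e' f' =
        (kroneckerCore (regularPart J N) right left).submatrix e f := by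
      rw [kroneckerCore_eq, Matrix.submatrix_submatrix]
      rfl
    have h2 : pencil A B = (P⁻¹).map C * (P.map C * pencil A B * Q.map C) * (Q⁻¹).map C := by
      rw [Matrix.mul_assoc, Matrix.mul_assoc _ (Q.map C), hQQ, Matrix.mul_one, ← Matrix.mul_assoc,
        hPP', Matrix.one_mul]
    rw [h1, h2, hpen, hPL, hQR, ← Matrix.submatrix_mul_equiv _ _ e f f,
      ← Matrix.submatrix_mul_equiv _ _ e e f]
    simp only [Matrix.mul_assoc]
  have hPLu : IsUnit PL.det := by
    rw [hPL, det_mul, det_submatrix_equiv_self]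
    exact (IsUnit.of_mul_eq_one (P.map C).det (by rw [← det_mul, hPP', det_one])).mul
      (isUnit_det_leftFactor r s right left)
  have hQRu : IsUnit QR.det := by
    rw [hQR, det_mul, det_submatrix_equiv_self]
    exact (isUnit_det_rightFactor r s right left).mul
      (IsUnit.of_mul_eq_one (Q.map C).det (by rw [← det_mul, hQQ', det_one]))
  set T := Q.submatrix id (f.symm ∘ g) with hT
  set L := P.submatrix (e.symm ∘ g') id with hL
  have hX : QR * (T.map C * vander right) = (fromRows 0 1).submatrix f' id := by
    have h1 : (Q⁻¹).map C * T.map C = (1 : Matrix (Fin n) (Fin n) ℂ[X]).submatrix id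
        (f.symm ∘ g) := by
      rw [← hQQ']; rfl
    have h2 : (rightFactor r s right left).submatrix f f *
        (1 : Matrix (Fin n) (Fin n) ℂ[X]).submatrix id (f.symm ∘ g) =
        ((rightFactor r s right left).submatrix id g).submatrix f id := by
      change ((rightFactor r s right left).submatrix f f * 1).submatrix id (f.symm ∘ g) = _
      rw [Matrix.mul_one]
      ext; simp
    have h3 : (rightFactor r s right left).submatrix id g =
        fromRows 0 (fromRows (blockDiagonal' fun i => bidiag (right i)) 0) := by
      ext1 x y
      rcases x with x | x | x <;> rfl
    rw [hQR, Matrix.mul_assoc, ← Matrix.mul_assoc _ (T.map C), h1, ← Matrix.mul_assoc, h2, h3]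
    change (fromRows 0 (fromRows (blockDiagonal' fun i => bidiag (right i)) 0) *
      vander right).submatrix f id = _
    rw [fromRows_mul, fromRows_mul, blockDiagonal'_bidiag_mul_vander, Matrix.zero_mul,
      Matrix.zero_mul]
    have h4 : (fromRows 0 (fromRows (zerothUnit ℂ[X] right) 0) : Matrix (KCol r s right left)
        (Fin k) ℂ[X]) = (fromRows 0 1).submatrix (colEquiv r s right left) id := by
      ext1 x y
      rw [zerothUnit_eq]
      rcases x with x | x | x
      · rfl
      · simp only [colEquiv, Matrix.submatrix_apply]
        rcases h : splitSigma right x with c | c <;> simp [h]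
      · rfl
    rw [h4]
    rfl
  have hY : ((vander left)ᵀ * L.map C) * PL = (fromCols 0 1).submatrix id e' := by
    have h1 : L.map C * (P⁻¹).map C = (1 : Matrix (Fin n) (Fin n) ℂ[X]).submatrix
        (e.symm ∘ g') id := by
      rw [← hPP]; rfl
    have h2 : (1 : Matrix (Fin n) (Fin n) ℂ[X]).submatrix (e.symm ∘ g') id *
        (leftFactor r s right left).submatrix e e =
        ((leftFactor r s right left).submatrix g' id).submatrix id e := by
      change (1 * (leftFactor r s right left).submatrix e e).submatrix (e.symm ∘ g') id = _
      rw [Matrix.one_mul]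
      ext; simp
    have h3 : (leftFactor r s right left).submatrix g' id =
        fromCols 0 (fromCols 0 (blockDiagonal' fun i => bidiag (left i))ᵀ) := by
      ext1 x y
      rcases y with y | y | y <;> rfl
    rw [hPL, Matrix.mul_assoc, ← Matrix.mul_assoc (L.map C), h1, h2, h3]
    change ((vander left)ᵀ * fromCols 0 (fromCols 0
      (blockDiagonal' fun i => bidiag (left i))ᵀ)).submatrix id e = _
    rw [Matrix.mul_fromCols, Matrix.mul_fromCols, ← Matrix.transpose_mul,
      blockDiagonal'_bidiag_mul_vander, Matrix.mul_zero, Matrix.mul_zero]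
    have h4 : (fromCols 0 (fromCols 0 (zerothUnit ℂ[X] left)ᵀ) : Matrix (Fin k)
        (KRow r s right left) ℂ[X]) = (fromCols 0 1).submatrix id (rowEquiv r s right left) := by
      ext1 y x
      rw [zerothUnit_eq]
      rcases x with x | x | x
      · rfl
      · rfl
      · simp only [rowEquiv, Matrix.submatrix_apply]
        rcases h : splitSigma left x with c | c <;> simp [h, Matrix.one_apply, eq_comm]
    rw [h4]
    rfl
  have hGdet : G.det = (regularPart J N).det := by
    rw [hG, det_fromBlocks_zero₂₁, det_one, mul_one]
  -- Units of `ℂ[X]` are constants, so the unimodular factors contribute only the scalar `c`.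
  obtain ⟨u, -, hu⟩ := Polynomial.isUnit_iff.mp hPLu
  obtain ⟨v, -, hv⟩ := Polynomial.isUnit_iff.mp hQRu
  have hu0 : u ≠ 0 := by rintro rfl; rw [← hu, map_zero] at hPLu; exact not_isUnit_zero hPLu
  have hv0 : v ≠ 0 := by rintro rfl; rw [← hv, map_zero] at hQRu; exact not_isUnit_zero hQRu
  -- Stated for a general `M` because it serves both finite points, with `A - z B`, and infinity,
  -- with `B`.
  have hrank : ∀ M : Matrix (Fin n) (Fin n) ℂ, ∀ R : Matrix (Fin r ⊕ Fin s) (Fin r ⊕ Fin s) ℂ,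
      ∀ M' N', P * M * Q = (fromBlocks R 0 0 (fromBlocks M' 0 0 N') :
        Matrix (KRow r s right left) (KCol r s right left) ℂ).submatrix e f →
      n ≤ M.rank + k → R.det ≠ 0 := by
    intro M R M' N' hM hr
    have h1 : M.rank = (P * M * Q).rank := by
      rw [Matrix.rank_mul_eq_left_of_isUnit_det _ _ hQd,
        Matrix.rank_mul_eq_right_of_isUnit_det _ _ hPd]
    rw [hM, Matrix.rank_submatrix] at h1
    have h2 := rank_le_of_regular_blocks right left R M' N'
    apply det_ne_zero_of_card_le_rank
    simp only [Fintype.card_sum, Fintype.card_fin]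
    omega
  refine ⟨⟨(regularPart J N).det,
    u * v * ((Equiv.Perm.sign (f'.trans e'.symm) : ℤ) : ℂ), T, (Q⁻¹).submatrix (f.symm ∘ g) id,
    L, (P⁻¹).submatrix id (e.symm ∘ g'), ?_, ?_, ?_, ?_, ?_, ?_, ?_, ?_, ?_, ?_⟩⟩
  · refine mul_ne_zero (mul_ne_zero hu0 hv0) ?_
    rcases Int.units_eq_one_or (Equiv.Perm.sign (f'.trans e'.symm)) with h | h <;> simp [h]
  · change (Q⁻¹ * Q).submatrix (f.symm ∘ g) (f.symm ∘ g) = 1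
    rw [Matrix.nonsing_inv_mul _ hQd]
    exact Matrix.submatrix_one _ (f.symm.injective.comp
      (Sum.inr_injective.comp Sum.inl_injective))
  · change (P * P⁻¹).submatrix (e.symm ∘ g') (e.symm ∘ g') = 1
    rw [Matrix.mul_nonsing_inv _ hPd]
    exact Matrix.submatrix_one _ (e.symm.injective.comp
      (Sum.inr_injective.comp Sum.inr_injective))
  · rw [hS, Matrix.mul_assoc, hX, Matrix.mul_assoc, Matrix.submatrix_mul_equiv]
    have : (fromBlocks G 0 0 0 : Matrix (KCore r s right left ⊕ Fin k)
        (KCore r s right left ⊕ Fin k) ℂ[X]) *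
        (fromRows 0 1 : Matrix (KCore r s right left ⊕ Fin k) (Fin k) ℂ[X]) = 0 := by
      rw [fromBlocks_mul_fromRows]
      simp
    rw [this]
    simp
  · rw [hS, Matrix.mul_assoc PL, ← Matrix.mul_assoc _ PL, hY, ← Matrix.mul_assoc,
      Matrix.submatrix_mul_equiv]
    have : (fromCols 0 1 : Matrix (Fin k) (KCore r s right left ⊕ Fin k) ℂ[X]) *
        (fromBlocks G 0 0 0 : Matrix (KCore r s right left ⊕ Fin k)
        (KCore r s right left ⊕ Fin k) ℂ[X]) = 0 := by
      rw [fromCols_mul_fromBlocks]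
      simp
    rw [this]
    simp
  · have h1 : B * Q = P⁻¹ * (kroneckerB N right left).submatrix e f := by
      rw [← hB, Matrix.mul_assoc P, Matrix.nonsing_inv_mul_cancel_left _ _ hPd]
    have h2 : B * T = P⁻¹ * ((kroneckerB N right left).submatrix id g).submatrix e id := by
      change (B * Q).submatrix id (f.symm ∘ g) = _
      rw [h1]
      change P⁻¹ * (kroneckerB N right left).submatrix e (f ∘ f.symm ∘ g) = _
      rw [← Function.comp_assoc, Equiv.self_comp_symm]
      rfl
    have h3 : (kroneckerB N right left).submatrix id g =
        fromRows 0 (fromRows (blockDiagonal' fun i => blockLB (right i)) 0) := by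
      ext1 x y
      rcases x with x | x | x <;> rfl
    rw [← Matrix.mul_assoc, h2, h3, Matrix.mul_assoc]
    change _ * (fromRows 0 (fromRows (blockDiagonal' fun i => blockLB (right i)) 0) *
      lastUnit right).submatrix e id = _
    rw [fromRows_mul, fromRows_mul, blockLB_mul_lastUnit]
    simp
  · have h1 : P * B = (kroneckerB N right left).submatrix e f * Q⁻¹ := by
      rw [← hB, Matrix.mul_nonsing_inv_cancel_right _ _ hQd]
    have h2 : L * B = ((kroneckerB N right left).submatrix g' id).submatrix id f * Q⁻¹ := by
      change (P * B).submatrix (e.symm ∘ g') id = _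
      rw [h1]
      change (kroneckerB N right left).submatrix (e ∘ e.symm ∘ g') f * Q⁻¹ = _
      rw [← Function.comp_assoc, Equiv.self_comp_symm]
      rfl
    have h3 : (kroneckerB N right left).submatrix g' id =
        fromCols 0 (fromCols 0 (blockDiagonal' fun i => blockLB (left i))ᵀ) := by
      rw [blockDiagonal'_transpose]
      ext1 x y
      rcases y with y | y | y <;> rfl
    rw [Matrix.mul_assoc, h2, h3, ← Matrix.mul_assoc]
    change ((lastUnit left)ᵀ * fromCols 0 (fromCols 0
      (blockDiagonal' fun i => blockLB (left i))ᵀ)).submatrix id f * _ = _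
    rw [Matrix.mul_fromCols, Matrix.mul_fromCols, ← Matrix.transpose_mul, blockLB_mul_lastUnit]
    simp
  · intro U D V
    rw [det_add_mul_mul_of_rank_form e' f' hS hPLu hQRu hY hX, hGdet, ← hu, ← hv]
    simp [mul_assoc]
  · intro z hz
    rw [regularPart, eval_det_pencil]
    refine hrank (A - z • B) _ ((blockDiagonal' fun i => blockLA (right i)) -
      z • (blockDiagonal' fun i => blockLB (right i)))
      ((blockDiagonal' fun i => (blockLA (left i))ᵀ) -
      z • (blockDiagonal' fun i => (blockLB (left i))ᵀ)) ?_ hz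
    rw [Matrix.mul_sub, Matrix.sub_mul, Matrix.mul_smul, Matrix.smul_mul, hA, hB]
    have h : kroneckerA J right left - z • kroneckerB N right left =
        fromBlocks (fromBlocks J 0 0 1 - z • fromBlocks 1 0 0 N) 0 0
        (fromBlocks ((blockDiagonal' fun i => blockLA (right i)) -
        z • (blockDiagonal' fun i => blockLB (right i))) 0 0
        ((blockDiagonal' fun i => (blockLA (left i))ᵀ) -
        z • (blockDiagonal' fun i => (blockLB (left i))ᵀ))) := by
      rw [kroneckerA, kroneckerB]
      simp only [fromBlocks_smul, fromBlocks_sub_fromBlocks, smul_zero, sub_zero]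
    rw [← h]
    rfl
  · intro hz
    rw [regularPart, natDegree_det_pencil _ _ (hrank B _ _ _ hB hz)]
    simp only [Fintype.card_sum, Fintype.card_fin]
    omega

/-! ### Null vectors of a perturbed matrix at a fixed point. -/

/-- The `k` independent columns of `X` lie in a kernel of dimension at most `k`, hence span it. -/
theorem exists_eq_mulVec_of_mulVec_eq_zero {n k : ℕ} {S : Matrix (Fin n) (Fin n) ℂ}
    {X : Matrix (Fin n) (Fin k) ℂ} (hSX : S * X = 0) (hX : ∀ c, X *ᵥ c = 0 → c = 0)
    (hr : n ≤ S.rank + k) {x : Fin n → ℂ} (hx : S *ᵥ x = 0) : ∃ c, X *ᵥ c = x := by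
  have hinj : Function.Injective X.mulVecLin := (injective_iff_map_eq_zero _).mpr hX
  have h1 := LinearMap.finrank_range_of_inj hinj
  have h2 := LinearMap.finrank_range_add_finrank_ker S.mulVecLin
  rw [Module.finrank_fintype_fun_eq_card, Fintype.card_fin] at h1 h2
  have hle : LinearMap.range X.mulVecLin ≤ LinearMap.ker S.mulVecLin := by
    rintro _ ⟨c, rfl⟩
    simp [hSX]
  have heq := Submodule.eq_of_le_of_finrank_le hle (by rw [Matrix.rank] at hr; omega)
  have : x ∈ LinearMap.range X.mulVecLin := by rw [heq]; exact hx
  exact this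

/-- The range of `S` lies in `ker Y`, which has dimension `n - k`, at most the rank of `S`. -/
theorem exists_mulVec_eq_of_mulVec_eq_zero {n k : ℕ} {S : Matrix (Fin n) (Fin n) ℂ}
    {Y : Matrix (Fin k) (Fin n) ℂ} (hYS : Y * S = 0) (hY : ∀ c, Yᵀ *ᵥ c = 0 → c = 0)
    (hr : n ≤ S.rank + k) {x : Fin n → ℂ} (hx : Y *ᵥ x = 0) : ∃ z, S *ᵥ z = x := by
  have hinj : Function.Injective Yᵀ.mulVecLin := (injective_iff_map_eq_zero _).mpr hY
  have h1 : Yᵀ.rank = k := by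
    rw [Matrix.rank, LinearMap.finrank_range_of_inj hinj, Module.finrank_fintype_fun_eq_card,
      Fintype.card_fin]
  rw [Matrix.rank_transpose, Matrix.rank] at h1
  have h2 := LinearMap.finrank_range_add_finrank_ker Y.mulVecLin
  rw [Module.finrank_fintype_fun_eq_card, Fintype.card_fin] at h2
  have hle : LinearMap.range S.mulVecLin ≤ LinearMap.ker Y.mulVecLin := by
    rintro _ ⟨c, rfl⟩
    simp [hYS]
  have heq := Submodule.eq_of_le_of_finrank_le hle (by rw [Matrix.rank] at hr; omega)
  have : x ∈ LinearMap.range S.mulVecLin := by rw [heq]; exact hx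
  exact this

/-- Multiplication by `Y` removes `S x` and leaves `τ (Y U) D W x = 0`; as `Y U` is invertible, both
summands vanish separately. -/
theorem mulVec_perturbed_eq_zero_iff {n k : ℕ} {S : Matrix (Fin n) (Fin n) ℂ}
    {U : Matrix (Fin n) (Fin k) ℂ} {D : Matrix (Fin k) (Fin k) ℂ} {W Y : Matrix (Fin k) (Fin n) ℂ}
    (hYS : Y * S = 0) (hYU : (Y * U).det ≠ 0) {τ : ℂ} (hτ : τ ≠ 0) (x : Fin n → ℂ) :
    (S + τ • (U * D * W)) *ᵥ x = 0 ↔ S *ᵥ x = 0 ∧ D *ᵥ (W *ᵥ x) = 0 := by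
  have hexp : (S + τ • (U * D * W)) *ᵥ x = S *ᵥ x + τ • (U *ᵥ (D *ᵥ (W *ᵥ x))) := by
    simp [Matrix.add_mulVec, Matrix.smul_mulVec, Matrix.mulVec_mulVec, Matrix.mul_assoc]
  rw [hexp]
  constructor
  · intro h
    have h1 : Y *ᵥ (S *ᵥ x + τ • (U *ᵥ (D *ᵥ (W *ᵥ x)))) = 0 := by rw [h, Matrix.mulVec_zero]
    rw [Matrix.mulVec_add, Matrix.mulVec_mulVec, hYS, Matrix.zero_mulVec, zero_add,
      Matrix.mulVec_smul, smul_eq_zero_iff_right hτ, Matrix.mulVec_mulVec] at h1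
    have h2 := Matrix.eq_zero_of_mulVec_eq_zero hYU h1
    rw [h2] at h
    exact ⟨by simpa using h, h2⟩
  · rintro ⟨h1, h2⟩
    simp [h1, h2]

/-- If `Y U` is singular while `W X` is not, then the null space of `S + τ U D W` contains a vector
that depends linearly on `τ`. -/
theorem exists_linear_null_vector {n k : ℕ} {S : Matrix (Fin n) (Fin n) ℂ}
    {U X : Matrix (Fin n) (Fin k) ℂ} {D : Matrix (Fin k) (Fin k) ℂ} {W Y : Matrix (Fin k) (Fin n) ℂ}
    (hSX : S * X = 0) (hYS : Y * S = 0) (hr : n ≤ S.rank + k) (hY : ∀ c, Yᵀ *ᵥ c = 0 → c = 0)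
    (hU : ∀ c, U *ᵥ c = 0 → c = 0) (hD : D.det ≠ 0) (hWX : (W * X).det ≠ 0)
    (hYU : (Y * U).det = 0) :
    ∃ w z : Fin n → ℂ, LinearIndependent ℂ ![w, z] ∧ ∀ τ : ℂ,
      (S + τ • (U * D * W)) *ᵥ (w + τ • z) = 0 ∧ W *ᵥ (w + τ • z) ≠ 0 := by
  obtain ⟨c, hc0, hc⟩ := Matrix.exists_mulVec_eq_zero_iff.mpr hYU
  have hWXu : IsUnit (W * X).det := hWX.isUnit
  have hDu : IsUnit D.det := hD.isUnit
  -- The vector `U c` is annihilated by `Y`, hence lies in the range of `S`.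
  obtain ⟨z0, hz0⟩ : ∃ z0, S *ᵥ z0 = -(U *ᵥ c) :=
    exists_mulVec_eq_of_mulVec_eq_zero hYS hY hr
      (by rw [Matrix.mulVec_neg, Matrix.mulVec_mulVec, hc, neg_zero])
  -- Chosen so that `S w = 0` and `D W w = c`.
  set w := X *ᵥ ((W * X)⁻¹ *ᵥ (D⁻¹ *ᵥ c)) with hw
  -- A kernel vector of `S` is subtracted to get `W z = 0` while `S z = -U c` persists; then `S (τ
  -- z)` cancels `τ U D W w`.
  set z := z0 - X *ᵥ ((W * X)⁻¹ *ᵥ (W *ᵥ z0)) with hz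
  have hWw : W *ᵥ w = D⁻¹ *ᵥ c := by
    rw [hw, Matrix.mulVec_mulVec, Matrix.mulVec_mulVec, Matrix.mul_nonsing_inv _ hWXu,
      Matrix.one_mulVec]
  have hDWw : D *ᵥ (W *ᵥ w) = c := by
    rw [hWw, Matrix.mulVec_mulVec, Matrix.mul_nonsing_inv _ hDu, Matrix.one_mulVec]
  have hWw0 : W *ᵥ w ≠ 0 := by
    intro h
    rw [h, Matrix.mulVec_zero] at hDWw
    exact hc0 hDWw.symm
  have hWz : W *ᵥ z = 0 := by
    rw [hz, Matrix.mulVec_sub, Matrix.mulVec_mulVec _ W X, Matrix.mulVec_mulVec,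
      Matrix.mul_nonsing_inv _ hWXu, Matrix.one_mulVec, sub_self]
  have hSw : S *ᵥ w = 0 := by rw [hw, Matrix.mulVec_mulVec, hSX, Matrix.zero_mulVec]
  have hSz : S *ᵥ z = -(U *ᵥ c) := by
    rw [hz, Matrix.mulVec_sub, hz0, Matrix.mulVec_mulVec _ S X, hSX, Matrix.zero_mulVec, sub_zero]
  have hz0 : z ≠ 0 := by
    intro h
    rw [h, Matrix.mulVec_zero] at hSz
    exact hc0 (hU c (neg_eq_zero.mp hSz.symm))
  refine ⟨w, z, ?_, fun τ => ⟨?_, ?_⟩⟩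
  · rw [LinearIndependent.pair_iff]
    intro s t hst
    have h1 := congrArg (fun v => W *ᵥ v) hst
    simp only [Matrix.mulVec_add, Matrix.mulVec_smul, hWz, smul_zero, add_zero,
      Matrix.mulVec_zero] at h1
    have hs : s = 0 := (smul_eq_zero.mp h1).resolve_right hWw0
    rw [hs, zero_smul, zero_add] at hst
    exact ⟨hs, (smul_eq_zero.mp hst).resolve_right hz0⟩
  · have hexp : ∀ x, (S + τ • (U * D * W)) *ᵥ x = S *ᵥ x + τ • (U *ᵥ (D *ᵥ (W *ᵥ x))) := by
      intro x
      simp [Matrix.add_mulVec, Matrix.smul_mulVec, Matrix.mulVec_mulVec, Matrix.mul_assoc]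
    rw [hexp, Matrix.mulVec_add, Matrix.mulVec_add, Matrix.mulVec_smul, Matrix.mulVec_smul, hWz,
      smul_zero, add_zero, hDWw, hSw, hSz]
    simp
  · rwa [Matrix.mulVec_add, Matrix.mulVec_smul, hWz, smul_zero, add_zero]

/-! ### Simple roots and eigenvalues of regular pencils. -/

/-- At a simple root of the determinant the rank drops by at most one. -/
theorem card_le_rank_add_one_of_rootMultiplicity_eq_one {ι : Type*} [Fintype ι] [DecidableEq ι]
    {M : Matrix ι ι ℂ[X]} {z : ℂ} (h : M.det.rootMultiplicity z = 1) :
    Fintype.card ι ≤ ((evalRingHom z).mapMatrix M).rank + 1 := by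
  set N := (evalRingHom z).mapMatrix M with hN
  have h0 : M.det ≠ 0 := by
    intro h'
    simp [h'] at h
  obtain ⟨g, hg, hgz⟩ := exists_eq_pow_rootMultiplicity_mul_and_not_dvd M.det h0 z
  rw [h, pow_one] at hg
  have hgz' : g.eval z ≠ 0 := fun h' => hgz (dvd_iff_isRoot.mpr h')
  have hdet : N.det = 0 := by
    rw [hN, ← RingHom.map_det, hg]
    simp
  -- If the adjugate vanished at `z`, it would be `(X - z) E`, and cancelling `X - z` in `M adj M =
  -- det M` would give `M E = g`. Taking determinants at `z` then yields `0 = g(z)^n` with `n` the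
  -- size, although `g(z) ≠ 0`.
  have hadj : N.adjugate ≠ 0 := by
    intro hadj
    rw [hN, ← RingHom.map_adjugate] at hadj
    have hdvd : ∀ i j, ∃ q, M.adjugate i j = (X - C z) * q := fun i j =>
      dvd_iff_isRoot.mpr (congrFun (congrFun hadj i) j)
    choose E hE using hdvd
    have h1 : M * Matrix.of E = g • (1 : Matrix ι ι ℂ[X]) := by
      have h2 : (X - C z) • (M * Matrix.of E) = (X - C z) • (g • (1 : Matrix ι ι ℂ[X])) := by
        rw [smul_smul, ← hg, ← Matrix.mul_adjugate, ← Matrix.mul_smul]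
        congr 1
        ext1 i j
        simp [hE]
      exact smul_right_injective _ (X_sub_C_ne_zero z) h2
    have h3 := congrArg (fun A => ((evalRingHom z).mapMatrix A).det) h1
    simp only [map_mul, det_mul] at h3
    rw [← hN, hdet, zero_mul, ← RingHom.map_det, det_smul, det_one, mul_one, map_pow] at h3
    exact pow_ne_zero _ hgz' h3.symm
  obtain ⟨i, j, hij⟩ : ∃ i j, N.adjugate i j ≠ 0 := by
    by_contra! hc
    exact hadj (by ext i j; exact hc i j)
  rw [Matrix.adjugate_apply] at hij
  -- A nonzero adjugate entry is the determinant of `N` with row `j` replaced by the unit row `i`. A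
  -- kernel vector with zero `i`-th coordinate is killed by that matrix, so this coordinate embeds
  -- the kernel in `ℂ`.
  let φ : LinearMap.ker N.mulVecLin →ₗ[ℂ] ℂ :=
    (LinearMap.proj i).comp (LinearMap.ker N.mulVecLin).subtype
  have hφ : Function.Injective φ := by
    refine (injective_iff_map_eq_zero _).mpr fun v hv => ?_
    have hv1 : (v : ι → ℂ) i = 0 := hv
    have hv2 : N *ᵥ (v : ι → ℂ) = 0 := v.2
    apply Subtype.ext
    refine Matrix.eq_zero_of_mulVec_eq_zero hij ?_
    funext l
    by_cases hl : l = j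
    · subst hl
      simp [Matrix.mulVec, hv1]
    · simpa [Matrix.mulVec, hl] using congrFun hv2 l
  have h1 := LinearMap.finrank_le_finrank_of_injective hφ
  have h2 := LinearMap.finrank_range_add_finrank_ker N.mulVecLin
  rw [Module.finrank_self] at h1
  rw [Module.finrank_fintype_fun_eq_card] at h2
  rw [Matrix.rank]
  omega

theorem ker_mulVecLin_eq_span {ι : Type*} [Fintype ι] {N : Matrix ι ι ℂ} {x : ι → ℂ} (hx : x ≠ 0)
    (hNx : N *ᵥ x = 0) (hr : Fintype.card ι ≤ N.rank + 1) :
    LinearMap.ker N.mulVecLin = Submodule.span ℂ {x} := by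
  symm
  have h2 := LinearMap.finrank_range_add_finrank_ker N.mulVecLin
  rw [Module.finrank_fintype_fun_eq_card] at h2
  apply Submodule.eq_of_le_of_finrank_le
  · rw [Submodule.span_singleton_le_iff_mem]
    exact hNx
  · rw [finrank_span_singleton hx]
    rw [Matrix.rank] at hr
    omega

theorem rank_le_nrank {ι : Type*} [Fintype ι] (A B : Matrix ι ι ℂ) (z : ℂ) :
    (A - z • B).rank ≤ nrank A B :=
  le_ciSup (f := fun z : ℂ => (A - z • B).rank)
    ⟨Fintype.card ι, by rintro _ ⟨z, rfl⟩; exact Matrix.rank_le_card_height _⟩ z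

theorem exists_rank_eq_nrank {ι : Type*} [Fintype ι] (A B : Matrix ι ι ℂ) :
    ∃ z : ℂ, (A - z • B).rank = nrank A B :=
  Nat.sSup_mem (s := Set.range fun z : ℂ => (A - z • B).rank) (Set.range_nonempty _)
    ⟨Fintype.card ι, by rintro _ ⟨z, rfl⟩; exact Matrix.rank_le_card_height _⟩

/-- A regular pencil has full normal rank, so any null vector forces a rank drop, also at infinity.
-/
theorem IsRegularPencil.isPencilEigenvalue {ι : Type*} [Fintype ι] [DecidableEq ι]
    {A B : Matrix ι ι ℂ} (h : IsRegularPencil A B) {μ : OnePoint ℂ} {x : ι → ℂ} (hx : x ≠ 0)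
    (hμ : pencilAt A B μ *ᵥ x = 0) : IsPencilEigenvalue A B μ := by
  obtain ⟨z, hz⟩ : ∃ z, (pencil A B).det.eval z ≠ 0 := by
    by_contra! hc
    exact h (Polynomial.funext fun z => by simpa using hc z)
  rw [eval_det_pencil] at hz
  have h1 := rank_le_nrank A B z
  rw [Matrix.rank_of_det_ne_zero hz] at h1
  refine lt_of_lt_of_le ?_ h1
  by_contra! hc
  exact det_ne_zero_of_card_le_rank hc (Matrix.exists_mulVec_eq_zero_iff.mp ⟨x, hx, hμ⟩)

/-! ### Genericity of simple zeros in prescribed number. -/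

/-- Each requirement is the nonvanishing of a polynomial in the parameters; `Θ` is their product,
and the single good point `z₀` shows that it is not zero. -/
theorem exists_nonvanishing_polynomial {σ : Type*} (F : (MvPolynomial σ ℂ)[X]) (d : ℕ)
    (hd : ∀ z, (F.map (MvPolynomial.eval z)).natDegree ≤ d) {h : ℂ[X]} (hh : h ≠ 0)
    (E : MvPolynomial σ ℂ) (z₀ : σ → ℂ) (h1 : (F.map (MvPolynomial.eval z₀)).natDegree = d)
    (h1' : F.map (MvPolynomial.eval z₀) ≠ 0)
    (h2 : (F.map (MvPolynomial.eval z₀)).Separable)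
    (h3 : ∀ ρ, h.eval ρ = 0 → (F.map (MvPolynomial.eval z₀)).eval ρ ≠ 0)
    (h4 : MvPolynomial.eval z₀ E ≠ 0) :
    ∃ Θ : MvPolynomial σ ℂ, MvPolynomial.eval z₀ Θ ≠ 0 ∧ ∀ z, MvPolynomial.eval z Θ ≠ 0 →
      (F.map (MvPolynomial.eval z)).natDegree = d ∧ (F.map (MvPolynomial.eval z)).Separable ∧
      (∀ ρ, h.eval ρ = 0 → (F.map (MvPolynomial.eval z)).eval ρ ≠ 0) ∧
      MvPolynomial.eval z E ≠ 0 := by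
  -- The resultant of `F` is taken with the fixed degrees `d` and `d - 1`; it specializes to the
  -- usual one wherever the degree does not drop.
  have hres : ∀ z, (F.map (MvPolynomial.eval z)).natDegree = d →
      MvPolynomial.eval z (resultant F (derivative F) d (d - 1)) =
        resultant (F.map (MvPolynomial.eval z)) (derivative (F.map (MvPolynomial.eval z))) := by
    intro z hz
    rw [← resultant_map_map, ← derivative_map, natDegree_derivative, hz]
  have hev : ∀ z ρ, MvPolynomial.eval z (F.eval (MvPolynomial.C ρ)) =
      (F.map (MvPolynomial.eval z)).eval ρ := by
    intro z ρ
    rw [Polynomial.eval_map, ← eval₂_at_apply, MvPolynomial.eval_C]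
  refine ⟨F.coeff d * resultant F (derivative F) d (d - 1) *
    (∏ ρ ∈ h.roots.toFinset, F.eval (MvPolynomial.C ρ)) * E, ?_, ?_⟩
  · simp only [map_mul, map_prod, hev, hres z₀ h1]
    refine mul_ne_zero (mul_ne_zero (mul_ne_zero ?_ (resultant_ne_zero _ _ h2)) ?_) h4
    · rw [← Polynomial.coeff_map, ← h1]
      exact leadingCoeff_ne_zero.mpr h1'
    · refine Finset.prod_ne_zero_iff.mpr fun ρ hρ => h3 ρ ?_
      rw [Multiset.mem_toFinset, mem_roots hh] at hρ
      exact hρ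
  · intro z hz
    simp only [map_mul, map_prod, hev, mul_ne_zero_iff] at hz
    obtain ⟨⟨⟨hc, hr⟩, hp⟩, hE⟩ := hz
    rw [← Polynomial.coeff_map] at hc
    have hdeg := le_antisymm (hd z) (le_natDegree_of_ne_zero hc)
    refine ⟨hdeg, ?_, ?_, hE⟩
    · rw [hres z hdeg, Ne, resultant_eq_zero_iff] at hr
      by_contra hs
      refine hr ⟨Or.inl ?_, hs⟩
      intro h0
      rw [h0] at hc
      simp at hc
    · intro ρ hρ
      refine Finset.prod_ne_zero_iff.mp hp ρ ?_
      rw [Multiset.mem_toFinset, mem_roots hh]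
      exact hρ

/-- Column `i` has entries of degree at most `m i`, and every Leibniz term takes one entry from each
column. -/
theorem natDegree_det_mul_vander_le {k : ℕ} (m : Fin k → ℕ)
    (Z : Matrix (Fin k) (Σ i : Fin k, Fin (m i + 1)) ℂ) :
    (Z.map C * vander m).det.natDegree ≤ ∑ i, m i := by
  rw [Matrix.det_apply]
  refine natDegree_sum_le_of_forall_le _ _ fun σ _ => ?_
  refine (natDegree_smul_le _ _).trans ((natDegree_prod_le _ _).trans
    (Finset.sum_le_sum fun i _ => ?_))
  rw [Matrix.mul_apply]
  refine natDegree_sum_le_of_forall_le _ _ fun a _ => ?_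
  simp only [vander, Matrix.map_apply, Matrix.of_apply]
  split_ifs with h
  · subst h
    exact (natDegree_C_mul_X_pow_le _ _).trans (Nat.lt_succ_iff.mp a.2.2)
  · simp

/-- The coefficient matrix for which `Z * vander m` is the diagonal matrix of given polynomials. -/
def coeffMatrix {k : ℕ} (m : Fin k → ℕ) (g : Fin k → ℂ[X]) :
    Matrix (Fin k) (Σ i : Fin k, Fin (m i + 1)) ℂ :=
  Matrix.of fun l a => if l = a.1 then (g l).coeff a.2 else 0

theorem coeffMatrix_mul_vander {k : ℕ} (m : Fin k → ℕ) (g : Fin k → ℂ[X])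
    (hg : ∀ i, (g i).natDegree ≤ m i) :
    (coeffMatrix m g).map C * vander m = Matrix.diagonal g := by
  ext1 l i
  rw [Matrix.mul_apply, Fintype.sum_sigma, Finset.sum_eq_single i]
  · by_cases h : l = i
    · subst h
      rw [Matrix.diagonal_apply_eq]
      conv_rhs => rw [(g l).as_sum_range_C_mul_X_pow' (Nat.lt_succ_of_le (hg l))]
      rw [Finset.sum_range]
      simp [coeffMatrix, vander]
    · simp [coeffMatrix, h]
  · intro j _ hj
    simp [vander, hj]
  · simp

theorem coeffMatrix_mul_lastUnit {k : ℕ} (m : Fin k → ℕ) (g : Fin k → ℂ[X])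
    (hg : ∀ i, (g i).coeff (m i) = 1) : coeffMatrix m g * lastUnit m = 1 := by
  ext1 l i
  rw [Matrix.mul_apply, Fintype.sum_sigma, Finset.sum_eq_single i]
  · rw [Finset.sum_eq_single (Fin.last (m i))]
    · by_cases h : l = i
      · subst h
        simp [coeffMatrix, lastUnit, hg]
      · simp [coeffMatrix, h]
    · intro b _ hb
      have : (b : ℕ) ≠ m i := fun h => hb (Fin.ext h)
      simp [lastUnit, this]
    · simp
  · intro j _ hj
    simp [lastUnit, hj]
  · simp

theorem exists_injective_avoiding {α : Type*} [Finite α] (s : Set ℂ) (hs : s.Finite) :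
    ∃ f : α → ℂ, Function.Injective f ∧ ∀ a, f a ∉ s := by
  have : Infinite (sᶜ : Set ℂ) := hs.infinite_compl.to_subtype
  have := Fintype.ofFinite α
  obtain ⟨f⟩ : Nonempty (α ↪ (sᶜ : Set ℂ)) := by
    obtain ⟨t, ht⟩ := Infinite.exists_subset_card_eq (sᶜ : Set ℂ) (Fintype.card α)
    refine ⟨((Fintype.equivFinOfCardEq rfl).trans
      (Fintype.equivFinOfCardEq (by simpa using ht)).symm).toEmbedding.trans
      (Function.Embedding.subtype (· ∈ t))⟩
  exact ⟨fun a => f a, Subtype.val_injective.comp f.injective, fun a => (f a).2⟩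

section Genericity

variable {n k : ℕ} {A B : Matrix (Fin n) (Fin n) ℂ} {right left : Fin k → ℕ}

/-- The determinant of a matrix applied to the polynomial basis of the right null space. -/
noncomputable def KernelData.rightDet (K : KernelData A B right left)
    (W : Matrix (Fin k) (Fin n) ℂ) : ℂ[X] :=
  (W.map C * (K.T.map C * vander right)).det

/-- The determinant of the polynomial basis of the left null space applied to a matrix. -/
noncomputable def KernelData.leftDet (K : KernelData A B right left)
    (U : Matrix (Fin n) (Fin k) ℂ) : ℂ[X] :=
  ((vander left)ᵀ * K.L.map C * U.map C).det

theorem KernelData.rightDet_eq (K : KernelData A B right left) (W : Matrix (Fin k) (Fin n) ℂ) :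
    K.rightDet W = ((W * K.T).map C * vander right).det := by
  rw [rightDet, ← Matrix.mul_assoc, Matrix.map_mul]

theorem KernelData.leftDet_eq (K : KernelData A B right left) (U : Matrix (Fin n) (Fin k) ℂ) :
    K.leftDet U = ((K.L * U)ᵀ.map C * vander left).det := by
  rw [leftDet, ← Matrix.det_transpose, Matrix.mul_assoc, Matrix.transpose_mul,
    Matrix.transpose_transpose, ← Matrix.map_mul, Matrix.transpose_map]

theorem KernelData.natDegree_rightDet_le (K : KernelData A B right left)
    (W : Matrix (Fin k) (Fin n) ℂ) : (K.rightDet W).natDegree ≤ ∑ i, right i := by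
  rw [K.rightDet_eq]
  exact natDegree_det_mul_vander_le _ _

theorem KernelData.natDegree_leftDet_le (K : KernelData A B right left)
    (U : Matrix (Fin n) (Fin k) ℂ) : (K.leftDet U).natDegree ≤ ∑ i, left i := by
  rw [K.leftDet_eq]
  exact natDegree_det_mul_vander_le _ _

/-- As `T' T = 1`, the product `W T` can be any constant matrix; it is chosen to make `W X(λ)`
diagonal with monic entries of degree `right i`. The leading coefficients then form the identity. -/
theorem KernelData.exists_rightDet_eq (K : KernelData A B right left)
    (t : (Σ i : Fin k, Fin (right i)) → ℂ) : ∃ W : Matrix (Fin k) (Fin n) ℂ,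
      K.rightDet W = ∏ a, (X - C (t a)) ∧ W * (K.T * lastUnit right) = 1 := by
  set g : Fin k → ℂ[X] := fun i => ∏ j, (X - C (t ⟨i, j⟩)) with hg
  have hdeg : ∀ i, (g i).natDegree = right i := fun i => by simp [hg]
  refine ⟨coeffMatrix right g * K.T', ?_, ?_⟩
  · rw [K.rightDet_eq, Matrix.mul_assoc, K.T'_mul_T, Matrix.mul_one,
      coeffMatrix_mul_vander _ _ fun i => (hdeg i).le, Matrix.det_diagonal, Fintype.prod_sigma]
  · rw [Matrix.mul_assoc, ← Matrix.mul_assoc K.T', K.T'_mul_T, Matrix.one_mul]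
    refine coeffMatrix_mul_lastUnit _ _ fun i => ?_
    rw [← hdeg i]
    exact (monic_prod_of_monic _ _ fun j _ => monic_X_sub_C _).coeff_natDegree

theorem KernelData.exists_leftDet_eq (K : KernelData A B right left)
    (t : (Σ i : Fin k, Fin (left i)) → ℂ) : ∃ U : Matrix (Fin n) (Fin k) ℂ,
      K.leftDet U = ∏ a, (X - C (t a)) ∧ (lastUnit left)ᵀ * K.L * U = 1 := by
  set g : Fin k → ℂ[X] := fun i => ∏ j, (X - C (t ⟨i, j⟩)) with hg
  have hdeg : ∀ i, (g i).natDegree = left i := fun i => by simp [hg]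
  refine ⟨K.L' * (coeffMatrix left g)ᵀ, ?_, ?_⟩
  · rw [K.leftDet_eq, ← Matrix.mul_assoc, K.L_mul_L', Matrix.one_mul, Matrix.transpose_transpose,
      coeffMatrix_mul_vander _ _ fun i => (hdeg i).le, Matrix.det_diagonal, Fintype.prod_sigma]
  · rw [Matrix.mul_assoc, ← Matrix.mul_assoc K.L, K.L_mul_L', Matrix.one_mul,
      ← Matrix.transpose_mul, coeffMatrix_mul_lastUnit, Matrix.transpose_one]
    intro i
    rw [← hdeg i]
    exact (monic_prod_of_monic _ _ fun j _ => monic_X_sub_C _).coeff_natDegree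

/-- The genericity condition on `(U, W)`: the nontrivial factor of the determinant of the perturbed
pencil has simple zeros, as many as possible, and none of them is a zero of `h`. -/
structure KernelData.IsGood (K : KernelData A B right left) (h : ℂ[X])
    (U : Matrix (Fin n) (Fin k) ℂ) (W : Matrix (Fin k) (Fin n) ℂ) : Prop where
  natDegree_eq : (K.leftDet U * K.rightDet W).natDegree = (∑ i, right i) + ∑ i, left i
  separable : (K.leftDet U * K.rightDet W).Separable
  eval_ne_zero : ∀ ρ, h.eval ρ = 0 → (K.leftDet U * K.rightDet W).eval ρ ≠ 0
  det_right_ne_zero : (W * (K.T * lastUnit right)).det ≠ 0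
  det_left_ne_zero : ((lastUnit left)ᵀ * K.L * U).det ≠ 0

/-- The coordinate ring of the space of pairs `(U, W)`. -/
abbrev EntryRing (n k : ℕ) : Type := MvPolynomial ((Fin n × Fin k) ⊕ (Fin k × Fin n)) ℂ

theorem map_det_mul {R S o κ : Type*} [CommRing R] [CommRing S] [Fintype o] [DecidableEq o]
    [Fintype κ] (φ : R →+* S) (M : Matrix o κ R) (N : Matrix κ o R) :
    φ (M * N).det = (M.map φ * N.map φ).det := by
  rw [RingHom.map_det, RingHom.mapMatrix_apply, Matrix.map_mul]

/-- The determinants are formed for matrices of indeterminates, so that each pair `(U, W)` is a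
specialization and one polynomial `Θ` controls all conditions. -/
theorem KernelData.holdsGenerically_isGood (K : KernelData A B right left) {h : ℂ[X]}
    (hh : h ≠ 0) : HoldsGenerically fun U V : Matrix (Fin n) (Fin k) ℂ => K.IsGood h U Vᴴ := by
  set Ug : Matrix (Fin n) (Fin k) (EntryRing n k) := Matrix.of fun i j => MvPolynomial.X (Sum.inl (i, j))
    with hUg
  set Wg : Matrix (Fin k) (Fin n) (EntryRing n k) := Matrix.of fun i j => MvPolynomial.X (Sum.inr (i, j))
    with hWg
  set ψ : ℂ[X] →+* (EntryRing n k)[X] := mapRingHom MvPolynomial.C with hψ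
  set F : (EntryRing n k)[X] := (((vander left)ᵀ * K.L.map C).map ψ * Ug.map C).det *
    (Wg.map C * (K.T.map C * vander right).map ψ).det with hF
  set E : EntryRing n k := (Wg * (K.T * lastUnit right).map (MvPolynomial.C : ℂ →+* EntryRing n k)).det *
    (((lastUnit left)ᵀ * K.L).map (MvPolynomial.C : ℂ →+* EntryRing n k) * Ug).det with hE
  have hsurj : ∀ z : (Fin n × Fin k) ⊕ (Fin k × Fin n) → ℂ,
      ∃ (U : Matrix (Fin n) (Fin k) ℂ) (W : Matrix (Fin k) (Fin n) ℂ), z = entries U W := fun z =>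
    ⟨Matrix.of fun i j => z (Sum.inl (i, j)), Matrix.of fun i j => z (Sum.inr (i, j)), by
      funext x; rcases x with x | x <;> rfl⟩
  have hψφ : ∀ (z) (M : ℂ[X]), (ψ M).map (MvPolynomial.eval z) = M := by
    intro z M
    rw [hψ, coe_mapRingHom, Polynomial.map_map]
    have : (MvPolynomial.eval z).comp MvPolynomial.C = RingHom.id ℂ := by ext; simp
    rw [this, Polynomial.map_id]
  have hFe : ∀ U W, F.map (MvPolynomial.eval (entries U W)) = K.leftDet U * K.rightDet W := by
    intro U W
    set Φ : (EntryRing n k)[X] →+* ℂ[X] := mapRingHom (MvPolynomial.eval (entries U W)) with hΦ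
    have h1 : (((vander left)ᵀ * K.L.map C).map ψ).map Φ = (vander left)ᵀ * K.L.map C := by
      ext1 i j
      exact hψφ _ _
    have h2 : ((K.T.map C * vander right).map ψ).map Φ = K.T.map C * vander right := by
      ext1 i j
      exact hψφ _ _
    have h3 : (Ug.map C).map Φ = U.map C := by
      ext1 i j
      simp [hΦ, hUg, entries]
    have h4 : (Wg.map C).map Φ = W.map C := by
      ext1 i j
      simp [hΦ, hWg, entries]
    change Φ F = _
    rw [hF, map_mul, map_det_mul, map_det_mul, h1, h2, h3, h4]
    rfl
  have hEe : ∀ U W, MvPolynomial.eval (entries U W) E =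
      (W * (K.T * lastUnit right)).det * ((lastUnit left)ᵀ * K.L * U).det := by
    intro U W
    set Φ : EntryRing n k →+* ℂ := MvPolynomial.eval (entries U W) with hΦ
    have h1 : ∀ {a b : Type} (M : Matrix a b ℂ), (M.map MvPolynomial.C).map Φ = M := by
      intro a b M
      ext1 i j
      simp [hΦ]
    have h3 : Ug.map Φ = U := by
      ext1 i j
      simp [hΦ, hUg, entries]
    have h4 : Wg.map Φ = W := by
      ext1 i j
      simp [hΦ, hWg, entries]
    rw [hE, map_mul, map_det_mul, map_det_mul, h1, h1, h3, h4]
  -- The good point: `M + N` distinct zeros off the zeros of `h`, distributed over the diagonal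
  -- entries on the two sides.
  obtain ⟨t, htinj, ht⟩ := exists_injective_avoiding
    (α := (Σ i : Fin k, Fin (left i)) ⊕ (Σ i : Fin k, Fin (right i))) {ρ | h.eval ρ = 0}
    (by
      have : {ρ | h.eval ρ = 0} = (h.roots.toFinset : Set ℂ) := by
        ext ρ; simp [hh]
      rw [this]
      exact Finset.finite_toSet _)
  obtain ⟨U₀, hU₀, hU₀'⟩ := K.exists_leftDet_eq (fun a => t (Sum.inl a))
  obtain ⟨W₀, hW₀, hW₀'⟩ := K.exists_rightDet_eq (fun a => t (Sum.inr a))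
  have hprod : K.leftDet U₀ * K.rightDet W₀ = ∏ a, (X - C (t a)) := by
    rw [hU₀, hW₀, Fintype.prod_sum_type]
  have hsplit : ∀ ρ, h.eval ρ = 0 → (∏ a, (X - C (t a))).eval ρ ≠ 0 := by
    intro ρ hρ
    rw [Polynomial.eval_prod]
    refine Finset.prod_ne_zero_iff.mpr fun a _ => ?_
    simp only [eval_sub, eval_X, eval_C]
    intro h0
    exact ht a (by rw [← sub_eq_zero.mp h0]; exact hρ)
  obtain ⟨Θ, hΘ₀, hΘ⟩ := exists_nonvanishing_polynomial F ((∑ i, right i) + ∑ i, left i)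
    (by
      intro z
      obtain ⟨U, W, rfl⟩ := hsurj z
      rw [hFe]
      have h1 := K.natDegree_leftDet_le U
      have h2 := K.natDegree_rightDet_le W
      exact natDegree_mul_le.trans (by omega))
    hh E (entries U₀ W₀)
    (by
      rw [hFe, hprod, natDegree_prod_of_monic _ _ fun a _ => monic_X_sub_C _]
      simp [add_comm])
    (by rw [hFe, hprod]; exact (monic_prod_of_monic _ _ fun a _ => monic_X_sub_C _).ne_zero)
    (by rw [hFe, hprod]; exact separable_prod_X_sub_C_iff.mpr htinj)
    (by rw [hFe, hprod]; exact hsplit)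
    (by rw [hEe, hW₀', hU₀']; simp)
  refine ⟨{z | MvPolynomial.eval z Θ ≠ 0}, ⟨{z | MvPolynomial.eval z Θ = 0}, ⟨{Θ}, by simp⟩, ?_,
    ?_⟩, ?_⟩
  · intro hu
    have : entries U₀ W₀ ∈ {z | MvPolynomial.eval z Θ = 0} := by
      rw [hu]
      trivial
    exact hΘ₀ this
  · intro z hz
    simpa using hz
  · intro U V hUV
    have := hΘ _ hUV
    rw [hFe, hEe, mul_ne_zero_iff] at this
    exact ⟨this.1, this.2.1, this.2.2.1, this.2.2.2.1, this.2.2.2.2⟩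

end Genericity

/-! ### Null spaces at zeros and at nonzeros of the two determinants. -/

open scoped ComplexOrder in
theorem rank_conjTranspose_complex {m o : Type*} [Fintype m] [Fintype o] (M : Matrix m o ℂ) :
    Mᴴ.rank = M.rank :=
  M.rank_conjTranspose

section NullSpaces

variable {n k : ℕ} {S : Matrix (Fin n) (Fin n) ℂ} {U V X : Matrix (Fin n) (Fin k) ℂ}
  {D : Matrix (Fin k) (Fin k) ℂ} {Y : Matrix (Fin k) (Fin n) ℂ}

theorem conjTranspose_perturbed (τ : ℂ) :
    (S + τ • (U * D * Vᴴ))ᴴ = Sᴴ + star τ • (V * Dᴴ * Uᴴ) := by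
  simp [Matrix.conjTranspose_mul, Matrix.mul_assoc]

theorem conjTranspose_transpose_mulVec_eq_zero {m o : Type*} [Fintype o] {M : Matrix m o ℂ}
    (hM : ∀ c, M *ᵥ c = 0 → c = 0) (c : o → ℂ) (hc : Mᴴᵀ *ᵥ c = 0) : c = 0 := by
  have : M *ᵥ star c = 0 := by
    have h1 := congrArg star hc
    rw [Matrix.star_mulVec, star_zero] at h1
    have h2 : Mᴴᵀᴴ = Mᵀ := by ext; simp
    rwa [h2, Matrix.vecMul_transpose] at h1
  exact star_eq_zero.mp (hM _ this)

theorem mulVec_eq_zero_of_rank_eq {m k : ℕ} {M : Matrix (Fin m) (Fin k) ℂ} (hM : M.rank = k)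
    (c : Fin k → ℂ) (hc : M *ᵥ c = 0) : c = 0 := by
  have h := LinearMap.finrank_range_add_finrank_ker M.mulVecLin
  rw [Module.finrank_fintype_fun_eq_card, Fintype.card_fin] at h
  rw [Matrix.rank] at hM
  have h1 : LinearMap.ker M.mulVecLin = ⊥ := Submodule.finrank_eq_zero.mp (by omega)
  exact LinearMap.ker_eq_bot'.mp h1 c hc

theorem mulVec_eq_zero_of_det_mul_ne_zero {W : Matrix (Fin k) (Fin n) ℂ} (h : (W * X).det ≠ 0)
    (c : Fin k → ℂ) (hc : X *ᵥ c = 0) : c = 0 := by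
  refine Matrix.eq_zero_of_mulVec_eq_zero h ?_
  rw [← Matrix.mulVec_mulVec, hc, Matrix.mulVec_zero]

/-- A vector `X c` with `V* X c = 0` does not feel the perturbation. The left vector is the linear
null vector of the adjoint problem, and the rank bound makes either one span its null space. -/
theorem null_spaces_of_det_eq_zero (hSX : S * X = 0) (hYS : Y * S = 0) (hr : n ≤ S.rank + k)
    (hX : ∀ c, X *ᵥ c = 0 → c = 0) (hV : ∀ c, V *ᵥ c = 0 → c = 0) (hD : D.det ≠ 0)
    (hVX : (Vᴴ * X).det = 0) (hYU : (Y * U).det ≠ 0)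
    (hN : ∀ τ : ℂ, τ ≠ 0 → n ≤ (S + τ • (U * D * Vᴴ)).rank + 1) :
    (∃ x : Fin n → ℂ, x ≠ 0 ∧ Vᴴ *ᵥ x = 0 ∧ ∀ τ : ℂ, τ ≠ 0 →
      LinearMap.ker (S + τ • (U * D * Vᴴ)).mulVecLin = Submodule.span ℂ {x}) ∧
    (∃ w z : Fin n → ℂ, LinearIndependent ℂ ![w, z] ∧ ∀ τ : ℂ, τ ≠ 0 →
      LinearMap.ker (S + τ • (U * D * Vᴴ))ᴴ.mulVecLin = Submodule.span ℂ {w + star τ • z} ∧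
      Uᴴ *ᵥ (w + star τ • z) ≠ 0) := by
  constructor
  · obtain ⟨c, hc0, hc⟩ := Matrix.exists_mulVec_eq_zero_iff.mpr hVX
    have hx : Vᴴ *ᵥ (X *ᵥ c) = 0 := by rw [Matrix.mulVec_mulVec, hc]
    have hx0 : X *ᵥ c ≠ 0 := fun h => hc0 (hX c h)
    refine ⟨X *ᵥ c, hx0, hx, fun τ hτ => ker_mulVecLin_eq_span hx0 ?_ (by simpa using hN τ hτ)⟩
    rw [Matrix.add_mulVec, Matrix.smul_mulVec, ← Matrix.mulVec_mulVec, hx, Matrix.mulVec_zero,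
      smul_zero, add_zero, Matrix.mulVec_mulVec, hSX, Matrix.zero_mulVec]
  -- Taking adjoints exchanges `U` with `V` and `X` with `Y*`, and replaces `τ` by its conjugate.
  · obtain ⟨w, z, hwz, h⟩ := exists_linear_null_vector (S := Sᴴ) (U := V) (X := Yᴴ) (D := Dᴴ)
      (W := Uᴴ) (Y := Xᴴ) (by rw [← Matrix.conjTranspose_mul, hYS, Matrix.conjTranspose_zero])
      (by rw [← Matrix.conjTranspose_mul, hSX, Matrix.conjTranspose_zero])
      (by rwa [rank_conjTranspose_complex]) (conjTranspose_transpose_mulVec_eq_zero hX) hV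
      (by rw [Matrix.det_conjTranspose]; exact star_ne_zero.mpr hD)
      (by rw [← Matrix.conjTranspose_mul, Matrix.det_conjTranspose]; exact star_ne_zero.mpr hYU)
      (by
        have := congrArg star hVX
        rwa [← Matrix.det_conjTranspose, Matrix.conjTranspose_mul,
          Matrix.conjTranspose_conjTranspose, star_zero] at this)
    refine ⟨w, z, hwz, fun τ hτ => ?_⟩
    obtain ⟨h1, h2⟩ := h (star τ)
    refine ⟨ker_mulVecLin_eq_span ?_ ?_ ?_, h2⟩
    · intro h0
      rw [h0, Matrix.mulVec_zero] at h2
      exact h2 rfl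
    · rwa [conjTranspose_perturbed]
    · rw [rank_conjTranspose_complex]
      simpa using hN τ hτ

theorem ker_perturbed_eq (hYS : Y * S = 0) (hYU : (Y * U).det ≠ 0) {τ : ℂ} (hτ : τ ≠ 0) :
    LinearMap.ker (S + τ • (U * D * Vᴴ)).mulVecLin =
      LinearMap.ker S.mulVecLin ⊓ LinearMap.ker (D * Vᴴ).mulVecLin := by
  ext x
  rw [Submodule.mem_inf, LinearMap.mem_ker, LinearMap.mem_ker, LinearMap.mem_ker]
  simp only [Matrix.mulVecLin_apply]
  rw [mulVec_perturbed_eq_zero_iff hYS hYU hτ, ← Matrix.mulVec_mulVec]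

theorem ker_inf_ker_eq_bot (hSX : S * X = 0) (hr : n ≤ S.rank + k) (hVX : (Vᴴ * X).det ≠ 0) :
    LinearMap.ker S.mulVecLin ⊓ LinearMap.ker Vᴴ.mulVecLin = ⊥ := by
  rw [Submodule.eq_bot_iff]
  rintro x ⟨hx, hVx⟩
  obtain ⟨c, rfl⟩ := exists_eq_mulVec_of_mulVec_eq_zero hSX (mulVec_eq_zero_of_det_mul_ne_zero hVX)
    hr hx
  have : (Vᴴ * X) *ᵥ c = 0 := by rw [← Matrix.mulVec_mulVec]; exact hVx
  rw [Matrix.eq_zero_of_mulVec_eq_zero hVX this, Matrix.mulVec_zero]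

theorem null_spaces_of_det_ne_zero (hSX : S * X = 0) (hYS : Y * S = 0) (hr : n ≤ S.rank + k)
    (hVX : (Vᴴ * X).det ≠ 0) (hYU : (Y * U).det ≠ 0) :
    (∃ Nr : Submodule ℂ (Fin n → ℂ), ∀ τ : ℂ, τ ≠ 0 →
      LinearMap.ker (S + τ • (U * D * Vᴴ)).mulVecLin = Nr) ∧
    ∀ τ : ℂ, τ ≠ 0 → LinearMap.ker (S + τ • (U * D * Vᴴ)).mulVecLin ⊓
      LinearMap.ker Vᴴ.mulVecLin = ⊥ := by
  refine ⟨⟨_, fun τ hτ => ker_perturbed_eq hYS hYU hτ⟩, fun τ hτ => ?_⟩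
  rw [ker_perturbed_eq hYS hYU hτ, eq_bot_iff, ← ker_inf_ker_eq_bot hSX hr hVX]
  exact inf_le_inf_right _ inf_le_left

/-- Invertibility of `V* X` allows a kernel vector `x` of `S` with `V* x = e`, which `D` then kills.
-/
theorem exists_null_vector_of_det_ne_zero (hSX : S * X = 0) (hVX : (Vᴴ * X).det ≠ 0)
    {e : Fin k → ℂ} (he : e ≠ 0) (hDe : D *ᵥ e = 0) :
    ∃ x : Fin n → ℂ, x ≠ 0 ∧ ∀ τ : ℂ, (S + τ • (U * D * Vᴴ)) *ᵥ x = 0 := by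
  have hVx : Vᴴ *ᵥ (X *ᵥ ((Vᴴ * X)⁻¹ *ᵥ e)) = e := by
    rw [Matrix.mulVec_mulVec, Matrix.mulVec_mulVec, Matrix.mul_nonsing_inv _ hVX.isUnit,
      Matrix.one_mulVec]
  refine ⟨X *ᵥ ((Vᴴ * X)⁻¹ *ᵥ e), ?_, fun τ => ?_⟩
  · intro h
    rw [h, Matrix.mulVec_zero] at hVx
    exact he hVx.symm
  · rw [Matrix.add_mulVec, Matrix.smul_mulVec, ← Matrix.mulVec_mulVec, ← Matrix.mulVec_mulVec, hVx,
      hDe, Matrix.mulVec_zero, smul_zero, add_zero, Matrix.mulVec_mulVec, hSX, Matrix.zero_mulVec]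

end NullSpaces

theorem exists_roots_of_separable {p : ℂ[X]} (hp : p.Separable) {m : ℕ} (hm : p.natDegree = m) :
    ∃ α : Fin m → ℂ, Function.Injective α ∧ ∀ i, p.eval (α i) = 0 := by
  have hcard : p.roots.toFinset.card = m := by
    rw [Multiset.toFinset_card_of_nodup (nodup_roots hp), ← hm]
    exact (IsAlgClosed.splits p).natDegree_eq_card_roots.symm
  refine ⟨fun i => (p.roots.toFinset.equivFinOfCardEq hcard).symm i,
    Subtype.val_injective.comp (Equiv.injective _), fun i => ?_⟩
  have h := ((p.roots.toFinset.equivFinOfCardEq hcard).symm i).2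
  rw [Multiset.mem_toFinset] at h
  exact isRoot_of_mem_roots h

/-! ### Null space bases at points of the extended plane. -/

section KernelBases

variable {n k : ℕ} {A B : Matrix (Fin n) (Fin n) ℂ} {right left : Fin k → ℕ}

/-- The basis of the right null space at a point of the extended complex plane. -/
noncomputable def KernelData.rightBasis (K : KernelData A B right left) :
    OnePoint ℂ → Matrix (Fin n) (Fin k) ℂ
  | OnePoint.infty => K.T * lastUnit right
  | OnePoint.some z => K.T * (vander right).map (eval z)

/-- The basis of the left null space at a point of the extended complex plane. -/
noncomputable def KernelData.leftBasis (K : KernelData A B right left) :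
    OnePoint ℂ → Matrix (Fin k) (Fin n) ℂ
  | OnePoint.infty => (lastUnit left)ᵀ * K.L
  | OnePoint.some z => ((vander left).map (eval z))ᵀ * K.L

theorem map_C_map_eval {m o : Type*} (M : Matrix m o ℂ) (z : ℂ) :
    (M.map C).map (evalRingHom z) = M := by
  ext; simp

theorem pencil_map_eval {ι : Type*} (A B : Matrix ι ι ℂ) (z : ℂ) :
    (pencil A B).map (evalRingHom z) = A - z • B := by
  ext
  simp [pencil]
  ring

theorem KernelData.pencilAt_mul_rightBasis (K : KernelData A B right left) (μ : OnePoint ℂ) :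
    pencilAt A B μ * K.rightBasis μ = 0 := by
  induction μ using OnePoint.rec with
  | infty => exact K.mul_lastUnit
  | coe z =>
    have h := congrArg (fun M => M.map (evalRingHom z)) K.pencil_mul
    simp only [Matrix.map_mul, map_C_map_eval, pencil_map_eval] at h
    rw [Matrix.map_zero _ (map_zero _)] at h
    exact h

theorem KernelData.leftBasis_mul_pencilAt (K : KernelData A B right left) (μ : OnePoint ℂ) :
    K.leftBasis μ * pencilAt A B μ = 0 := by
  induction μ using OnePoint.rec with
  | infty => exact K.lastUnit_mul
  | coe z =>
    have h := congrArg (fun M => M.map (evalRingHom z)) K.mul_pencil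
    simp only [Matrix.map_mul, map_C_map_eval, pencil_map_eval] at h
    rw [Matrix.map_zero _ (map_zero _)] at h
    exact h

theorem KernelData.eval_rightDet (K : KernelData A B right left) (W : Matrix (Fin k) (Fin n) ℂ)
    (z : ℂ) : (K.rightDet W).eval z = (W * K.rightBasis (z : OnePoint ℂ)).det := by
  rw [← coe_evalRingHom, rightDet, map_det_mul, Matrix.map_mul, map_C_map_eval, map_C_map_eval]
  rfl

theorem KernelData.eval_leftDet (K : KernelData A B right left) (U : Matrix (Fin n) (Fin k) ℂ)
    (z : ℂ) : (K.leftDet U).eval z = (K.leftBasis (z : OnePoint ℂ) * U).det := by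
  rw [← coe_evalRingHom, leftDet, map_det_mul, Matrix.map_mul, map_C_map_eval, map_C_map_eval]
  rfl

/-- The zeroth entries of the blocks are `1` at every `z` and already isolate each coefficient. -/
theorem vander_map_eval_mulVec_zero {m : Fin k → ℕ} (z : ℂ) (c : Fin k → ℂ)
    (hc : (vander m).map (eval z) *ᵥ c = 0) : c = 0 := by
  funext i
  have h := congrFun hc ⟨i, 0⟩
  simpa [Matrix.mulVec, dotProduct, vander, apply_ite (eval z)] using h

theorem KernelData.rightBasis_mulVec_eq_zero (K : KernelData A B right left) (z : ℂ)
    (c : Fin k → ℂ) (hc : K.rightBasis (z : OnePoint ℂ) *ᵥ c = 0) : c = 0 := by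
  refine vander_map_eval_mulVec_zero (m := right) z c ?_
  have h := congrArg (fun v => K.T' *ᵥ v) hc
  simp only [Matrix.mulVec_zero, Matrix.mulVec_mulVec] at h
  change (K.T' * (K.T * (vander right).map (eval z))) *ᵥ c = 0 at h
  rwa [← Matrix.mul_assoc, K.T'_mul_T, Matrix.one_mul] at h

theorem KernelData.leftBasis_transpose_mulVec_eq_zero (K : KernelData A B right left) (z : ℂ)
    (c : Fin k → ℂ) (hc : (K.leftBasis (z : OnePoint ℂ))ᵀ *ᵥ c = 0) : c = 0 := by
  refine vander_map_eval_mulVec_zero (m := left) z c ?_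
  have h := congrArg (fun v => K.L'ᵀ *ᵥ v) hc
  simp only [Matrix.mulVec_zero, Matrix.mulVec_mulVec] at h
  rw [← Matrix.transpose_mul] at h
  change (((vander left).map (eval z))ᵀ * K.L * K.L')ᵀ *ᵥ c = 0 at h
  rwa [Matrix.mul_assoc, K.L_mul_L', Matrix.mul_one, Matrix.transpose_transpose] at h

/-- Some perturbation `U W` of rank at most `k` makes `A - z B` invertible, so the rank of `A - z B`
is at least `n - k`. -/
theorem KernelData.le_rank_of_eval_ne_zero (K : KernelData A B right left) {z : ℂ}
    (hz : K.χ.eval z ≠ 0) : n ≤ (A - z • B).rank + k := by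
  -- All zeros are put at `z + 1`, so that neither determinant vanishes at `z`.
  obtain ⟨U, hU, -⟩ := K.exists_leftDet_eq fun _ => z + 1
  obtain ⟨W, hW, -⟩ := K.exists_rightDet_eq fun _ => z + 1
  have h := congrArg (eval z) (K.det_eq (U.map C) 1 (W.map C))
  change _ = eval z (C K.c * (K.χ * K.leftDet U * (1 : Matrix (Fin k) (Fin k) ℂ[X]).det *
    K.rightDet W)) at h
  have h0 : (A - z • B + U * W).det ≠ 0 := by
    have h1 : (pencil A B + U.map C * (1 : Matrix (Fin k) (Fin k) ℂ[X]) * W.map C).det.eval z = (A - z • B + U * W).det := by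
      rw [← coe_evalRingHom, RingHom.map_det, RingHom.mapMatrix_apply, Matrix.mul_one,
        Matrix.map_add _ (map_add _), pencil_map_eval, Matrix.map_mul, map_C_map_eval,
        map_C_map_eval]
    rw [← h1, h, hU, hW]
    simp [K.c_ne_zero, hz]
  have h2 := Matrix.rank_of_det_ne_zero h0
  have h3 := matrix_rank_add_le (A - z • B) (U * W)
  have h4 := (Matrix.rank_mul_le_left U W).trans U.rank_le_card_width
  simp only [Fintype.card_fin] at h2 h4
  omega

end KernelBases

/-! ### Eigenvalues and null spaces of the perturbed pencil. -/

theorem pencil_perturb {n k : ℕ} (A B : Matrix (Fin n) (Fin n) ℂ) (U V : Matrix (Fin n) (Fin k) ℂ)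
    (a b : Fin k → ℂ) (τ : ℂ) :
    pencil (perturb A U V a τ) (perturb B U V b τ) =
      pencil A B + U.map C * (C τ • pencil (diagonal a) (diagonal b)) * Vᴴ.map C := by
  have h : ∀ d : Fin k → ℂ, (U * diagonal d * Vᴴ).map C =
      U.map C * (diagonal d).map C * Vᴴ.map (C : ℂ →+* ℂ[X]) := fun d => by
    rw [Matrix.map_mul, Matrix.map_mul]
  have hs : ∀ M : Matrix (Fin n) (Fin n) ℂ, (τ • M).map (C : ℂ →+* ℂ[X]) = C τ • M.map C :=
    fun M => by ext1 i j; simp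
  simp only [pencil, perturb, Matrix.map_add _ (map_add C), hs, h]
  simp only [Matrix.smul_mul, Matrix.mul_smul, Matrix.mul_sub, Matrix.sub_mul, smul_add, smul_sub,
    smul_comm (X : ℂ[X]) (C τ)]
  abel

theorem pencilAt_perturb {n k : ℕ} (A B : Matrix (Fin n) (Fin n) ℂ)
    (U V : Matrix (Fin n) (Fin k) ℂ) (a b : Fin k → ℂ) (τ : ℂ) (μ : OnePoint ℂ) :
    pencilAt (perturb A U V a τ) (perturb B U V b τ) μ =
      pencilAt A B μ + τ • (U * pencilAt (diagonal a) (diagonal b) μ * Vᴴ) := by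
  induction μ using OnePoint.rec with
  | infty => rfl
  | coe z =>
    change A + τ • (U * diagonal a * Vᴴ) - z • (B + τ • (U * diagonal b * Vᴴ)) =
      A - z • B + τ • (U * (diagonal a - z • diagonal b) * Vᴴ)
    simp only [Matrix.smul_mul, Matrix.mul_smul, Matrix.mul_sub, Matrix.sub_mul, smul_add,
      smul_sub, smul_comm z τ]
    abel

theorem pencilAt_diagonal_mulVec_single {k : ℕ} (a b : Fin k → ℂ) (i : Fin k) :
    pencilAt (diagonal a) (diagonal b) (extendedQuotient (a i) (b i)) *ᵥ Pi.single i 1 = 0 := by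
  unfold extendedQuotient
  split_ifs with h
  · change diagonal b *ᵥ _ = 0
    rw [Matrix.diagonal_mulVec_single, h]
    simp
  · change (diagonal a - (a i / b i) • diagonal b) *ᵥ _ = 0
    rw [Matrix.sub_mulVec, Matrix.smul_mulVec, Matrix.diagonal_mulVec_single,
      Matrix.diagonal_mulVec_single, ← Pi.single_smul, ← Pi.single_sub]
    simp [div_mul_cancel₀ _ h]

theorem eval_det_pencil_diagonal_eq_zero {k : ℕ} (a b : Fin k → ℂ) (i : Fin k) {z : ℂ}
    (hz : (z : OnePoint ℂ) = extendedQuotient (a i) (b i)) :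
    (pencil (diagonal a) (diagonal b)).det.eval z = 0 := by
  rw [eval_det_pencil]
  refine Matrix.exists_mulVec_eq_zero_iff.mp ⟨Pi.single i 1, by simp, ?_⟩
  have h := pencilAt_diagonal_mulVec_single a b i
  rw [← hz] at h
  exact h

section Perturbed

variable {n k : ℕ} {A B : Matrix (Fin n) (Fin n) ℂ} {right left : Fin k → ℕ}
  {U V : Matrix (Fin n) (Fin k) ℂ} {a b : Fin k → ℂ}

theorem KernelData.det_perturbed (K : KernelData A B right left) (τ : ℂ) :
    (pencil (perturb A U V a τ) (perturb B U V b τ)).det =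
      C (K.c * τ ^ k) * ((K.χ * (pencil (diagonal a) (diagonal b)).det) *
        (K.leftDet U * K.rightDet Vᴴ)) := by
  rw [pencil_perturb, K.det_eq, Matrix.det_smul, Fintype.card_fin, leftDet, rightDet, C_mul, C_pow]
  ring

theorem KernelData.χ_ne_zero (K : KernelData A B right left) (hrank : nrank A B + k = n) :
    K.χ ≠ 0 := by
  obtain ⟨z, hz⟩ := exists_rank_eq_nrank A B
  intro h
  exact K.eval_ne_zero z (by omega) (by rw [h, eval_zero])

theorem KernelData.IsGood.isRegularPencil {K : KernelData A B right left}
    (hK : K.IsGood (K.χ * (pencil (diagonal a) (diagonal b)).det) U Vᴴ)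
    (hχ : K.χ * (pencil (diagonal a) (diagonal b)).det ≠ 0) {τ : ℂ} (hτ : τ ≠ 0) :
    IsRegularPencil (perturb A U V a τ) (perturb B U V b τ) := by
  rw [IsRegularPencil, K.det_perturbed]
  exact mul_ne_zero (C_ne_zero.mpr (mul_ne_zero K.c_ne_zero (pow_ne_zero _ hτ)))
    (mul_ne_zero hχ hK.separable.ne_zero)

theorem KernelData.IsGood.rootMultiplicity_eq {K : KernelData A B right left}
    (hK : K.IsGood (K.χ * (pencil (diagonal a) (diagonal b)).det) U Vᴴ)
    (hχ : K.χ * (pencil (diagonal a) (diagonal b)).det ≠ 0) {τ : ℂ} (hτ : τ ≠ 0) (z : ℂ) :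
    (pencil (perturb A U V a τ) (perturb B U V b τ)).det.rootMultiplicity z =
      K.χ.rootMultiplicity z + (pencil (diagonal a) (diagonal b)).det.rootMultiplicity z +
        (K.leftDet U * K.rightDet Vᴴ).rootMultiplicity z := by
  have h0 := hK.isRegularPencil hχ hτ
  rw [IsRegularPencil, K.det_perturbed] at h0
  rw [K.det_perturbed, rootMultiplicity_mul h0, rootMultiplicity_C,
    rootMultiplicity_mul (right_ne_zero_of_mul h0), rootMultiplicity_mul hχ, zero_add]

theorem KernelData.IsGood.rootMultiplicity_eq_one {K : KernelData A B right left}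
    (hK : K.IsGood (K.χ * (pencil (diagonal a) (diagonal b)).det) U Vᴴ)
    (hχ : K.χ * (pencil (diagonal a) (diagonal b)).det ≠ 0) {τ : ℂ} (hτ : τ ≠ 0) {z : ℂ}
    (hz : (K.leftDet U * K.rightDet Vᴴ).eval z = 0) :
    (pencil (perturb A U V a τ) (perturb B U V b τ)).det.rootMultiplicity z = 1 := by
  have h1 : (K.χ * (pencil (diagonal a) (diagonal b)).det).eval z ≠ 0 := fun h =>
    hK.eval_ne_zero z h hz
  rw [eval_mul, mul_ne_zero_iff] at h1
  have h2 := (rootMultiplicity_pos hK.separable.ne_zero).mpr hz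
  have h3 := rootMultiplicity_le_one_of_separable hK.separable z
  rw [hK.rootMultiplicity_eq hχ hτ, rootMultiplicity_eq_zero h1.1, rootMultiplicity_eq_zero h1.2]
  omega

/-- At a finite `γ_i` only the factor `det D` vanishes. At infinity `n = deg χ + M + N + k`, so the
degree deficit of the product equals that of `det D`. -/
theorem KernelData.IsGood.algMult_eq {K : KernelData A B right left}
    (hK : K.IsGood (K.χ * (pencil (diagonal a) (diagonal b)).det) U Vᴴ)
    (hχ : K.χ * (pencil (diagonal a) (diagonal b)).det ≠ 0) {τ : ℂ} (hτ : τ ≠ 0) {i : Fin k}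
    (hr : n ≤ (pencilAt A B (extendedQuotient (a i) (b i))).rank + k) :
    algMult (perturb A U V a τ) (perturb B U V b τ) (extendedQuotient (a i) (b i)) =
      algMult (diagonal a) (diagonal b) (extendedQuotient (a i) (b i)) := by
  generalize hμ : extendedQuotient (a i) (b i) = μ at hr ⊢
  induction μ using OnePoint.rec with
  | infty =>
    change Fintype.card (Fin n) - natDegree _ = Fintype.card (Fin k) - natDegree _
    have h0 := hK.isRegularPencil hχ hτ
    rw [IsRegularPencil, K.det_perturbed] at h0
    have h1 := K.natDegree_eq hr
    rw [K.det_perturbed, natDegree_C_mul (C_ne_zero.mp (left_ne_zero_of_mul h0)),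
      natDegree_mul hχ hK.separable.ne_zero, hK.natDegree_eq,
      natDegree_mul (left_ne_zero_of_mul hχ) (right_ne_zero_of_mul hχ), Fintype.card_fin,
      Fintype.card_fin]
    omega
  | coe z =>
    change rootMultiplicity z _ = rootMultiplicity z _
    have h1 := eval_det_pencil_diagonal_eq_zero a b i hμ.symm
    have h2 := hK.eval_ne_zero z (by rw [eval_mul, h1, mul_zero])
    rw [hK.rootMultiplicity_eq hχ hτ, rootMultiplicity_eq_zero (K.eval_ne_zero z hr),
      rootMultiplicity_eq_zero h2, zero_add, add_zero]

theorem KernelData.IsGood.not_isPencilEigenvalue {K : KernelData A B right left}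
    (hK : K.IsGood (K.χ * (pencil (diagonal a) (diagonal b)).det) U Vᴴ)
    (hrank : nrank A B + k = n) {z : ℂ} (hz : (K.leftDet U * K.rightDet Vᴴ).eval z = 0) :
    ¬ IsPencilEigenvalue A B (z : OnePoint ℂ) ∧
      ∀ j, (z : OnePoint ℂ) ≠ extendedQuotient (a j) (b j) := by
  have h1 : (K.χ * (pencil (diagonal a) (diagonal b)).det).eval z ≠ 0 := fun h =>
    hK.eval_ne_zero z h hz
  rw [eval_mul, mul_ne_zero_iff] at h1
  refine ⟨?_, fun j hj => h1.2 (eval_det_pencil_diagonal_eq_zero a b j hj)⟩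
  have h2 := K.le_rank_of_eval_ne_zero h1.1
  change ¬ (A - z • B).rank < nrank A B
  omega

theorem le_rank_perturbed_add_one {τ z : ℂ}
    (h : (pencil (perturb A U V a τ) (perturb B U V b τ)).det.rootMultiplicity z = 1) :
    n ≤ (pencilAt A B (z : OnePoint ℂ) +
      τ • (U * pencilAt (diagonal a) (diagonal b) (z : OnePoint ℂ) * Vᴴ)).rank + 1 := by
  have h1 := card_le_rank_add_one_of_rootMultiplicity_eq_one h
  rw [RingHom.mapMatrix_apply, pencil_map_eval, Fintype.card_fin] at h1
  rw [← pencilAt_perturb]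
  exact h1

theorem KernelData.IsGood.right_root {K : KernelData A B right left}
    (hK : K.IsGood (K.χ * (pencil (diagonal a) (diagonal b)).det) U Vᴴ)
    (hχ : K.χ * (pencil (diagonal a) (diagonal b)).det ≠ 0) (hV : V.rank = k) {z : ℂ}
    (hz : (K.rightDet Vᴴ).eval z = 0) :
    (∀ τ : ℂ, τ ≠ 0 →
      IsSimpleEigenvalue (perturb A U V a τ) (perturb B U V b τ) (z : OnePoint ℂ)) ∧
    (∃ x : Fin n → ℂ, x ≠ 0 ∧ Vᴴ *ᵥ x = 0 ∧ ∀ τ : ℂ, τ ≠ 0 →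
      rightNull (perturb A U V a τ) (perturb B U V b τ) (z : OnePoint ℂ) =
        Submodule.span ℂ {x}) ∧
    (∃ w z' : Fin n → ℂ, LinearIndependent ℂ ![w, z'] ∧ ∀ τ : ℂ, τ ≠ 0 →
      leftNull (perturb A U V a τ) (perturb B U V b τ) (z : OnePoint ℂ) =
        Submodule.span ℂ {w + star τ • z'} ∧
      Uᴴ *ᵥ (w + star τ • z') ≠ 0) := by
  have hqp : (K.leftDet U * K.rightDet Vᴴ).eval z = 0 := by rw [eval_mul, hz, mul_zero]
  have hh : (K.χ * (pencil (diagonal a) (diagonal b)).det).eval z ≠ 0 := fun h =>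
    hK.eval_ne_zero z h hqp
  rw [eval_mul, mul_ne_zero_iff, eval_det_pencil] at hh
  -- Factors of a separable product are coprime and share no zero.
  have hq : (K.leftDet U).eval z ≠ 0 := by
    intro hq
    obtain ⟨u, v, huv⟩ := hK.separable.isCoprime
    have := congrArg (eval z) huv
    simp [hq, hz] at this
  have hmult : ∀ τ : ℂ, τ ≠ 0 → _ := fun τ hτ => hK.rootMultiplicity_eq_one hχ hτ hqp
  obtain ⟨hR, hL⟩ := null_spaces_of_det_eq_zero (V := V) (U := U)
    (D := pencilAt (diagonal a) (diagonal b) (z : OnePoint ℂ))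
    (K.pencilAt_mul_rightBasis (z : OnePoint ℂ)) (K.leftBasis_mul_pencilAt (z : OnePoint ℂ))
    (K.le_rank_of_eval_ne_zero hh.1) (K.rightBasis_mulVec_eq_zero z)
    (mulVec_eq_zero_of_rank_eq hV) hh.2 (by rw [← K.eval_rightDet, hz])
    (by rwa [← K.eval_leftDet]) (fun τ hτ => le_rank_perturbed_add_one (hmult τ hτ))
  simp only [← pencilAt_perturb] at hR hL
  refine ⟨fun τ hτ => ⟨hK.isRegularPencil hχ hτ, ?_, hmult τ hτ⟩, hR, hL⟩
  obtain ⟨x, hx0, -, hx⟩ := hR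
  refine (hK.isRegularPencil hχ hτ).isPencilEigenvalue hx0 ?_
  have : x ∈ Submodule.span ℂ {x} := Submodule.mem_span_singleton_self x
  rw [← hx τ hτ] at this
  exact this

theorem KernelData.IsGood.left_root {K : KernelData A B right left}
    (hK : K.IsGood (K.χ * (pencil (diagonal a) (diagonal b)).det) U Vᴴ)
    (hχ : K.χ * (pencil (diagonal a) (diagonal b)).det ≠ 0) (hU : U.rank = k) {z : ℂ}
    (hz : (K.leftDet U).eval z = 0) :
    (∀ τ : ℂ, τ ≠ 0 →
      IsSimpleEigenvalue (perturb A U V a τ) (perturb B U V b τ) (z : OnePoint ℂ)) ∧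
    (∃ y : Fin n → ℂ, y ≠ 0 ∧ Uᴴ *ᵥ y = 0 ∧ ∀ τ : ℂ, τ ≠ 0 →
      leftNull (perturb A U V a τ) (perturb B U V b τ) (z : OnePoint ℂ) =
        Submodule.span ℂ {y}) ∧
    (∃ w z' : Fin n → ℂ, LinearIndependent ℂ ![w, z'] ∧ ∀ τ : ℂ, τ ≠ 0 →
      rightNull (perturb A U V a τ) (perturb B U V b τ) (z : OnePoint ℂ) =
        Submodule.span ℂ {w + τ • z'} ∧
      Vᴴ *ᵥ (w + τ • z') ≠ 0) := by
  have hqp : (K.leftDet U * K.rightDet Vᴴ).eval z = 0 := by rw [eval_mul, hz, zero_mul]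
  have hh : (K.χ * (pencil (diagonal a) (diagonal b)).det).eval z ≠ 0 := fun h =>
    hK.eval_ne_zero z h hqp
  rw [eval_mul, mul_ne_zero_iff, eval_det_pencil] at hh
  have hp : (K.rightDet Vᴴ).eval z ≠ 0 := by
    intro hp
    obtain ⟨u, v, huv⟩ := hK.separable.isCoprime
    have := congrArg (eval z) huv
    simp [hp, hz] at this
  have hmult : ∀ τ : ℂ, τ ≠ 0 → _ := fun τ hτ => hK.rootMultiplicity_eq_one hχ hτ hqp
  set S := pencilAt A B (z : OnePoint ℂ) with hS
  set D := pencilAt (diagonal a) (diagonal b) (z : OnePoint ℂ) with hD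
  have hconj : ∀ τ : ℂ, Sᴴ + star τ • (V * Dᴴ * Uᴴ) =
      (pencilAt (perturb A U V a τ) (perturb B U V b τ) (z : OnePoint ℂ))ᴴ := fun τ => by
    rw [pencilAt_perturb, conjTranspose_perturbed]
  -- The right-hand case for the adjoint pencil. The parameter there is the conjugate of `τ`, so
  -- conjugating it again makes the right null vector affine in `τ` itself.
  obtain ⟨hL, hR⟩ := null_spaces_of_det_eq_zero (V := U) (U := V) (S := Sᴴ) (D := Dᴴ)
    (X := (K.leftBasis (z : OnePoint ℂ))ᴴ) (Y := (K.rightBasis (z : OnePoint ℂ))ᴴ)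
    (by rw [← Matrix.conjTranspose_mul, K.leftBasis_mul_pencilAt, Matrix.conjTranspose_zero])
    (by rw [← Matrix.conjTranspose_mul, K.pencilAt_mul_rightBasis, Matrix.conjTranspose_zero])
    (by rw [rank_conjTranspose_complex]; exact K.le_rank_of_eval_ne_zero hh.1)
    (by
      have h1 := conjTranspose_transpose_mulVec_eq_zero (K.leftBasis_transpose_mulVec_eq_zero z)
      exact h1)
    (mulVec_eq_zero_of_rank_eq hU)
    (by rw [Matrix.det_conjTranspose]; exact star_ne_zero.mpr hh.2)
    (by rw [← Matrix.conjTranspose_mul, Matrix.det_conjTranspose, ← K.eval_leftDet, hz, star_zero])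
    (by
      have h1 : (K.rightBasis (z : OnePoint ℂ))ᴴ * V = (Vᴴ * K.rightBasis (z : OnePoint ℂ))ᴴ := by
        rw [Matrix.conjTranspose_mul, Matrix.conjTranspose_conjTranspose]
      rw [h1, Matrix.det_conjTranspose, ← K.eval_rightDet]
      exact star_ne_zero.mpr hp)
    (fun τ hτ => by
      have h1 := le_rank_perturbed_add_one (hmult (star τ) (star_ne_zero.mpr hτ))
      rw [← pencilAt_perturb, ← rank_conjTranspose_complex, ← hconj, star_star] at h1
      exact h1)
  refine ⟨fun τ hτ => ⟨hK.isRegularPencil hχ hτ, ?_, hmult τ hτ⟩, ?_, ?_⟩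
  · obtain ⟨w, z', -, h⟩ := hR
    obtain ⟨h1, h2⟩ := h (star τ) (star_ne_zero.mpr hτ)
    rw [hconj, star_star, Matrix.conjTranspose_conjTranspose] at h1
    rw [star_star] at h2
    refine (hK.isRegularPencil hχ hτ).isPencilEigenvalue (x := w + τ • z') ?_ ?_
    · intro h0
      rw [h0, Matrix.mulVec_zero] at h2
      exact h2 rfl
    · have : w + τ • z' ∈ Submodule.span ℂ {w + τ • z'} := Submodule.mem_span_singleton_self _
      rw [← h1] at this
      exact this
  · obtain ⟨y, hy0, hy, h⟩ := hL
    refine ⟨y, hy0, hy, fun τ hτ => ?_⟩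
    have h1 := h (star τ) (star_ne_zero.mpr hτ)
    rw [hconj] at h1
    exact h1
  · obtain ⟨w, z', hwz, h⟩ := hR
    refine ⟨w, z', hwz, fun τ hτ => ?_⟩
    obtain ⟨h1, h2⟩ := h (star τ) (star_ne_zero.mpr hτ)
    rw [hconj, star_star, Matrix.conjTranspose_conjTranspose] at h1
    rw [star_star] at h2
    exact ⟨h1, h2⟩

/-- A finite `γ_i` is a zero of `det D`, hence a forbidden point for `p q`; at infinity the two
conditions on leading coefficients apply. -/
theorem KernelData.IsGood.det_bases_ne_zero {K : KernelData A B right left}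
    (hK : K.IsGood (K.χ * (pencil (diagonal a) (diagonal b)).det) U Vᴴ) (i : Fin k) :
    (Vᴴ * K.rightBasis (extendedQuotient (a i) (b i))).det ≠ 0 ∧
      (K.leftBasis (extendedQuotient (a i) (b i)) * U).det ≠ 0 := by
  generalize hμ : extendedQuotient (a i) (b i) = μ
  induction μ using OnePoint.rec with
  | infty => exact ⟨hK.det_right_ne_zero, hK.det_left_ne_zero⟩
  | coe z =>
    have h1 := eval_det_pencil_diagonal_eq_zero a b i hμ.symm
    have h2 := hK.eval_ne_zero z (by rw [eval_mul, h1, mul_zero])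
    rw [eval_mul, mul_ne_zero_iff, K.eval_leftDet, K.eval_rightDet] at h2
    exact ⟨h2.2, h2.1⟩

theorem KernelData.IsGood.prescribed_eigenvalue {K : KernelData A B right left}
    (hK : K.IsGood (K.χ * (pencil (diagonal a) (diagonal b)).det) U Vᴴ)
    (hχ : K.χ * (pencil (diagonal a) (diagonal b)).det ≠ 0) {i : Fin k}
    (hr : n ≤ (pencilAt A B (extendedQuotient (a i) (b i))).rank + k) :
    (∀ τ : ℂ, τ ≠ 0 →
      IsPencilEigenvalue (perturb A U V a τ) (perturb B U V b τ)
        (extendedQuotient (a i) (b i)) ∧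
      algMult (perturb A U V a τ) (perturb B U V b τ) (extendedQuotient (a i) (b i)) =
        algMult (Matrix.diagonal a) (Matrix.diagonal b) (extendedQuotient (a i) (b i))) ∧
    (∃ Nr : Submodule ℂ (Fin n → ℂ), ∀ τ : ℂ, τ ≠ 0 →
      rightNull (perturb A U V a τ) (perturb B U V b τ) (extendedQuotient (a i) (b i)) = Nr) ∧
    (∃ Nl : Submodule ℂ (Fin n → ℂ), ∀ τ : ℂ, τ ≠ 0 →
      leftNull (perturb A U V a τ) (perturb B U V b τ) (extendedQuotient (a i) (b i)) = Nl) ∧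
    (∀ τ : ℂ, τ ≠ 0 →
      rightNull (perturb A U V a τ) (perturb B U V b τ) (extendedQuotient (a i) (b i)) ⊓
        LinearMap.ker Vᴴ.mulVecLin = ⊥ ∧
      leftNull (perturb A U V a τ) (perturb B U V b τ) (extendedQuotient (a i) (b i)) ⊓
        LinearMap.ker Uᴴ.mulVecLin = ⊥) := by
  obtain ⟨hVX, hYU⟩ := hK.det_bases_ne_zero i
  have hDe := pencilAt_diagonal_mulVec_single a b i
  have halg := fun τ (hτ : τ ≠ 0) => hK.algMult_eq hχ hτ hr
  generalize extendedQuotient (a i) (b i) = μ at *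
  set S := pencilAt A B μ with hS
  set D := pencilAt (diagonal a) (diagonal b) μ with hD
  have hconj : ∀ τ : ℂ, Sᴴ + star τ • (V * Dᴴ * Uᴴ) =
      (pencilAt (perturb A U V a τ) (perturb B U V b τ) μ)ᴴ := fun τ => by
    rw [pencilAt_perturb, conjTranspose_perturbed]
  have hSX := K.pencilAt_mul_rightBasis μ
  have hYS := K.leftBasis_mul_pencilAt μ
  obtain ⟨⟨Nr, hNr⟩, hR⟩ := null_spaces_of_det_ne_zero (U := U) (V := V) (D := D) hSX hYS hr hVX hYU
  obtain ⟨⟨Nl, hNl⟩, hL⟩ := null_spaces_of_det_ne_zero (U := V) (V := U) (S := Sᴴ) (D := Dᴴ)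
    (X := (K.leftBasis μ)ᴴ) (Y := (K.rightBasis μ)ᴴ)
    (by rw [← Matrix.conjTranspose_mul, hYS, Matrix.conjTranspose_zero])
    (by rw [← Matrix.conjTranspose_mul, hSX, Matrix.conjTranspose_zero])
    (by rwa [rank_conjTranspose_complex])
    (by rw [← Matrix.conjTranspose_mul, Matrix.det_conjTranspose]; exact star_ne_zero.mpr hYU)
    (by
      have h1 : (K.rightBasis μ)ᴴ * V = (Vᴴ * K.rightBasis μ)ᴴ := by
        rw [Matrix.conjTranspose_mul, Matrix.conjTranspose_conjTranspose]
      rw [h1, Matrix.det_conjTranspose]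
      exact star_ne_zero.mpr hVX)
  refine ⟨fun τ hτ => ⟨?_, halg τ hτ⟩, ⟨Nr, fun τ hτ => ?_⟩, ⟨Nl, fun τ hτ => ?_⟩,
    fun τ hτ => ⟨?_, ?_⟩⟩
  · obtain ⟨x, hx0, hx⟩ := exists_null_vector_of_det_ne_zero (U := U) hSX hVX
      (e := Pi.single i 1) (by simp) hDe
    refine (hK.isRegularPencil hχ hτ).isPencilEigenvalue hx0 ?_
    rw [pencilAt_perturb]
    exact hx τ
  · rw [rightNull, pencilAt_perturb]
    exact hNr τ hτ
  · rw [leftNull, ← hconj]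
    exact hNl _ (star_ne_zero.mpr hτ)
  · rw [rightNull, pencilAt_perturb]
    exact hR τ hτ
  · rw [leftNull, ← hconj]
    exact hL _ (star_ne_zero.mpr hτ)

end Perturbed

/-! ### Assembly of the theorem. -/

theorem mainTheorem2 (n k : ℕ) (A B : Matrix (Fin n) (Fin n) ℂ)
    (hsing : ¬ IsRegularPencil A B) (hrank : nrank A B + k = n)
    (left right : Fin k → ℕ) (hmin : HasMinimalIndices A B right left)
    (a b : Fin k → ℂ) (hreg : IsRegularPencil (Matrix.diagonal a) (Matrix.diagonal b))
    (hγ : ∀ i, ¬ IsPencilEigenvalue A B (extendedQuotient (a i) (b i))) :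
    HoldsGenerically fun U V : Matrix (Fin n) (Fin k) ℂ =>
      U.rank = k → V.rank = k →
      -- the perturbed pencils are regular
      (∀ τ : ℂ, τ ≠ 0 → IsRegularPencil (perturb A U V a τ) (perturb B U V b τ)) ∧
      ∃ (α : Fin (∑ i, right i) → ℂ) (β : Fin (∑ i, left i) → ℂ),
        -- all these values are pairwise distinct and differ from all other eigenvalues
        Function.Injective (Sum.elim α β) ∧
        (∀ i, ¬ IsPencilEigenvalue A B (α i : OnePoint ℂ) ∧
          ∀ j, (α i : OnePoint ℂ) ≠ extendedQuotient (a j) (b j)) ∧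
        (∀ i, ¬ IsPencilEigenvalue A B (β i : OnePoint ℂ) ∧
          ∀ j, (β i : OnePoint ℂ) ≠ extendedQuotient (a j) (b j)) ∧
        -- part 1
        (∀ i,
          (∀ τ : ℂ, τ ≠ 0 →
            IsSimpleEigenvalue (perturb A U V a τ) (perturb B U V b τ) (α i : OnePoint ℂ)) ∧
          (∃ x : Fin n → ℂ, x ≠ 0 ∧ Vᴴ *ᵥ x = 0 ∧ ∀ τ : ℂ, τ ≠ 0 →
            rightNull (perturb A U V a τ) (perturb B U V b τ) (α i : OnePoint ℂ) =
              Submodule.span ℂ {x}) ∧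
          (∃ w z : Fin n → ℂ, LinearIndependent ℂ ![w, z] ∧ ∀ τ : ℂ, τ ≠ 0 →
            leftNull (perturb A U V a τ) (perturb B U V b τ) (α i : OnePoint ℂ) =
              Submodule.span ℂ {w + star τ • z} ∧
            Uᴴ *ᵥ (w + star τ • z) ≠ 0)) ∧
        -- part 2
        (∀ i,
          (∀ τ : ℂ, τ ≠ 0 →
            IsSimpleEigenvalue (perturb A U V a τ) (perturb B U V b τ) (β i : OnePoint ℂ)) ∧
          (∃ y : Fin n → ℂ, y ≠ 0 ∧ Uᴴ *ᵥ y = 0 ∧ ∀ τ : ℂ, τ ≠ 0 →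
            leftNull (perturb A U V a τ) (perturb B U V b τ) (β i : OnePoint ℂ) =
              Submodule.span ℂ {y}) ∧
          (∃ w z : Fin n → ℂ, LinearIndependent ℂ ![w, z] ∧ ∀ τ : ℂ, τ ≠ 0 →
            rightNull (perturb A U V a τ) (perturb B U V b τ) (β i : OnePoint ℂ) =
              Submodule.span ℂ {w + τ • z} ∧
            Vᴴ *ᵥ (w + τ • z) ≠ 0)) ∧
        -- part 3
        (∀ i,
          (∀ τ : ℂ, τ ≠ 0 →
            IsPencilEigenvalue (perturb A U V a τ) (perturb B U V b τ)
              (extendedQuotient (a i) (b i)) ∧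
            algMult (perturb A U V a τ) (perturb B U V b τ) (extendedQuotient (a i) (b i)) =
              algMult (Matrix.diagonal a) (Matrix.diagonal b) (extendedQuotient (a i) (b i))) ∧
          (∃ Nr : Submodule ℂ (Fin n → ℂ), ∀ τ : ℂ, τ ≠ 0 →
            rightNull (perturb A U V a τ) (perturb B U V b τ) (extendedQuotient (a i) (b i)) =
              Nr) ∧
          (∃ Nl : Submodule ℂ (Fin n → ℂ), ∀ τ : ℂ, τ ≠ 0 →
            leftNull (perturb A U V a τ) (perturb B U V b τ) (extendedQuotient (a i) (b i)) =
              Nl) ∧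
          (∀ τ : ℂ, τ ≠ 0 →
            rightNull (perturb A U V a τ) (perturb B U V b τ) (extendedQuotient (a i) (b i)) ⊓
              LinearMap.ker Vᴴ.mulVecLin = ⊥ ∧
            leftNull (perturb A U V a τ) (perturb B U V b τ) (extendedQuotient (a i) (b i)) ⊓
              LinearMap.ker Uᴴ.mulVecLin = ⊥)) := by
  obtain ⟨K⟩ := exists_kernelData hmin
  have hχ : K.χ * (pencil (diagonal a) (diagonal b)).det ≠ 0 :=
    mul_ne_zero (K.χ_ne_zero hrank) hreg
  obtain ⟨Ω, hΩ, hgood⟩ := K.holdsGenerically_isGood hχ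
  refine ⟨Ω, hΩ, fun U V hUV hU hV => ?_⟩
  have hK := hgood U V hUV
  refine ⟨fun τ hτ => hK.isRegularPencil hχ hτ, ?_⟩
  have hne := hK.separable.ne_zero
  have hdeg := hK.natDegree_eq
  -- The degrees sum to `M + N` and are bounded by `N` and `M`, so both bounds are attained.
  rw [natDegree_mul (left_ne_zero_of_mul hne) (right_ne_zero_of_mul hne)] at hdeg
  have hq := K.natDegree_leftDet_le U
  have hp := K.natDegree_rightDet_le Vᴴ
  obtain ⟨α, hαinj, hα⟩ := exists_roots_of_separable hK.separable.of_mul_right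
    (m := ∑ i, right i) (by omega)
  obtain ⟨β, hβinj, hβ⟩ := exists_roots_of_separable hK.separable.of_mul_left
    (m := ∑ i, left i) (by omega)
  refine ⟨α, β, hαinj.sumElim hβinj fun i j hij => ?_, fun i => ?_, fun i => ?_, fun i => ?_,
    fun i => ?_, fun i => ?_⟩
  · obtain ⟨u, v, huv⟩ := hK.separable.isCoprime
    have := congrArg (eval (α i)) huv
    rw [eval_add, eval_mul, eval_mul, hα, hij, hβ] at this
    simp at this
  · exact hK.not_isPencilEigenvalue hrank (by rw [eval_mul, hα, mul_zero])
  · exact hK.not_isPencilEigenvalue hrank (by rw [eval_mul, hβ, zero_mul])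
  · exact hK.right_root hχ hV (hα i)
  · exact hK.left_root hχ hU (hβ i)
  · have h := hγ i
    rw [IsPencilEigenvalue] at h
    exact hK.prescribed_eigenvalue hχ (by omega)
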